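/- Let $(\Omega,\mathcal F,\mathbb P)$ be a probability space, $n\in\mathbb N$ and $T\ge 0$. Let $L_1,\dots,L_n$ be independent, increasing, pure jump Lévy processes ($L_i(t)$ is the sum of the jumps of $L_i$ up to time $t$) whose jump measures $N_i(dt,dz)$ have the predictable compensators $dt\,\nu_i(dz)$, and assume $\int_{(0,\infty)}z\,\nu_i(dz)<\infty$. Let $(\mathcal F_t)$ be the filtration generated by $L_1,\dots,L_n$. For each $i$ let $\lambda_i>0$ and $y_i\in\mathbb R$ be constants, let $\sigma_i$ be a deterministic, measurable, positive and bounded function on $[0,T]$, let $\Lambda_i$ be a deterministic positive function on $[0,T]$, and let $Y_i$ solve on $[0,T]$ $$dY_i(t)=-\lambda_iY_i(t)\,dt+\sigma_i(t)\,dL_i(t),\qquad Y_i(0)=y_i .$$ The spot price is $E(t)=\sum_{i=1}^n\Lambda_i(t)Y_i(t)$. Let $0\le T_1<T_2\le T$, assume that each $\Lambda_i$ is integrable on $[T_1,T_2]$, and let the price at time $t\le T_2$ of the futures with delivery period $[T_1,T_2]$ be $$F(t,T_1,T_2)=\mathbb E\Big[\frac1{T_2-T_1}\int_{T_1}^{T_2}E(u)\,du\,\Big|\,\mathcal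 F_t\Big].$$ Then almost surely $E$ is integrable on $[T_1,T_2]$, the payoff $\frac1{T_2-T_1}\int_{T_1}^{T_2}E(u)\,du$ is an integrable random variable, and the following hold almost surely, for each fixed $t$. If $0\le t\le T_1$, then $$F(t,T_1,T_2)=\sum_{i=1}^n Y_i(t)\frac1{T_2-T_1}\int_{T_1}^{T_2}\Lambda_i(u)e^{-\lambda_i(u-t)}\,du+\sum_{i=1}^n\frac1{T_2-T_1}\int_{T_1}^{T_2}\int_t^u\int_{(0,\infty)}\sigma_i(s)\Lambda_i(u)e^{-\lambda_i(u-s)}z\,\nu_i(dz)\,ds\,du .$$ If $T_1\le t\le T_2$, then $$F(t,T_1,T_2)=\frac1{T_2-T_1}\int_{T_1}^tE(u)\,du+\sum_{i=1}^n Y_i(t)\frac1{T_2-T_1}\int_t^{T_2}\Lambda_i(u)e^{-\lambda_i(u-t)}\,du+\sum_{i=1}^n\frac1{T_2-T_1}\int_t^{T_2}\int_t^u\int_{(0,\infty)}\sigma_i(s)\Lambda_i(u)e^{-\lambda_i(u-s)}z\,\nu_i(dz)\,ds\,du .$$ -/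

import Mathlib

open MeasureTheory ProbabilityTheory Set Filter Topology
open scoped NNReal ENNReal

noncomputable section

/-- The jump `Δf(s) = f(s) - f(s-)` of a path `f : [0,∞) → ℝ`; it is `0` at `s = 0`. -/
def pathJump (f : ℝ≥0 → ℝ) (s : ℝ≥0) : ℝ := f s - Function.leftLim f s

/-- The jump measure `N(ds, dz)` of a path: the sum of the unit masses at `(s, Δf(s))` over all
times `s` with `Δf(s) ≠ 0`. For a measurable set `B`, `N(B)` is the number of `s` with
`Δf(s) ≠ 0` and `(s, Δf(s)) ∈ B`. -/
def jumpMeasure (f : ℝ≥0 → ℝ) : Measure (ℝ≥0 × ℝ) :=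
  Measure.sum fun s : {s : ℝ≥0 // pathJump f s ≠ 0} => Measure.dirac (s.1, pathJump f s.1)

open Classical in
/-- The Lebesgue–Stieltjes measure `df` on `ℝ` of an increasing right-continuous path
`f : [0,∞) → ℝ` (extended by `f(0)` to negative times, so that `df` has no mass in `(-∞, 0]`). -/
def pathStieltjes (f : ℝ≥0 → ℝ) : Measure ℝ :=
  if hf : Monotone f then
    (show Monotone fun x : ℝ => f x.toNNReal from
      fun _ _ hxy => hf (Real.toNNReal_mono hxy)).stieltjesFunction.measure
  else 0

/-- A real-valued Lévy process: it starts at `0`, has independent and stationary increments,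
and has càdlàg paths. -/
structure IsLevyProcess {Ω : Type*} {mΩ : MeasurableSpace Ω} (L : ℝ≥0 → Ω → ℝ)
    (P : Measure Ω) : Prop where
  measurable : ∀ t, Measurable (L t)
  start_zero : ∀ ω, L 0 ω = 0
  indep_increments : HasIndepIncrements L P
  stationary_increments :
    ∀ s h : ℝ≥0, IdentDistrib (fun ω => L (s + h) ω - L s ω) (L h) P P
  right_continuous : ∀ ω t, ContinuousWithinAt (fun s => L s ω) (Ici t) t
  left_limits : ∀ ω t, ∃ l : ℝ, Tendsto (fun s => L s ω) (𝓝[<] t) (𝓝 l)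

/-- An increasing pure jump Lévy process with Lévy measure `ν`: its paths are increasing and equal
to the sum of their jumps, and the jump measure `N` has intensity `dt ν(dz)`, that is,
`E[N((s,t] × A)] = (t - s) ν(A)`. As `L` is a Lévy process, this says that the predictable
compensator of `N` is the deterministic measure `dt ν(dz)`. -/
structure IsIncreasingPureJumpLevy {Ω : Type*} {mΩ : MeasurableSpace Ω} (L : ℝ≥0 → Ω → ℝ)
    (ν : Measure ℝ) (P : Measure Ω) : Prop extends IsLevyProcess L P where
  monotone_paths : ∀ ω, Monotone fun s => L s ω
  pure_jump :
    ∀ ω (t : ℝ≥0), HasSum (fun s : Ioc 0 t => pathJump (fun r => L r ω) s) (L t ω)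
  jump_intensity : ∀ s t : ℝ≥0, s ≤ t → ∀ A : Set ℝ, MeasurableSet A →
    ∫⁻ ω, jumpMeasure (fun r => L r ω) (Ioc s t ×ˢ A) ∂P = ((t - s : ℝ≥0) : ℝ≥0∞) * ν A

/-- `Y` solves `dY(t) = -lam Y(t) dt + σ(t) dL(t)`, `Y(0) = y`, on `[0, T]`, for a driving process
`L` with increasing right-continuous paths: almost surely,
`Y(t) = y - ∫₀ᵗ lam Y(s) ds + ∫_{(0,t]} σ(s) dL(s)` for all `t ∈ [0, T]`, where the last integral
is the pathwise Lebesgue–Stieltjes integral. -/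
def IsOUSolution {Ω : Type*} {mΩ : MeasurableSpace Ω} (T : ℝ≥0) (lam y : ℝ) (σ : ℝ → ℝ)
    (L Y : ℝ≥0 → Ω → ℝ) (P : Measure Ω) : Prop :=
  ∀ᵐ ω ∂P, IntervalIntegrable (fun s : ℝ => Y s.toNNReal ω) volume 0 T ∧
    ∀ t : ℝ≥0, t ≤ T →
      Y t ω = y - (∫ s in (0 : ℝ)..t, lam * Y s.toNNReal ω)
        + ∫ s in Ioc (0 : ℝ) t, σ s ∂(pathStieltjes fun r => L r ω)

/-- The filtration generated by the processes `L 0, …, L (n-1)`: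
`ℱ t` is generated by all `L i s` with `s ≤ t`. -/
def generatedFiltration {Ω : Type*} {mΩ : MeasurableSpace Ω} {n : ℕ} (L : Fin n → ℝ≥0 → Ω → ℝ)
    (hL : ∀ i t, Measurable (L i t)) : Filtration ℝ≥0 mΩ :=
  Filtration.natural (fun t ω i => L i t ω)
    fun t => (measurable_pi_lambda _ fun i => hL i t).stronglyMeasurable

/-- The spot price `E(t) = ∑ᵢ Λᵢ(t) Yᵢ(t)`. -/
def spotPrice {Ω : Type*} {n : ℕ} (Λ : Fin n → ℝ → ℝ) (Y : Fin n → ℝ≥0 → Ω → ℝ)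
    (t : ℝ≥0) (ω : Ω) : ℝ := ∑ i, Λ i t * Y i t ω

/-- The payoff `(T₂ - T₁)⁻¹ ∫_{T₁}^{T₂} E(u) du` of the futures. -/
def futuresPayoff {Ω : Type*} (E : ℝ≥0 → Ω → ℝ) (T₁ T₂ : ℝ≥0) (ω : Ω) : ℝ :=
  1 / ((T₂ : ℝ) - T₁) * ∫ u in (T₁ : ℝ)..T₂, E u.toNNReal ω

/-- The futures price `F(t; T₁, T₂)`: the conditional expectation of the payoff given `ℱ t`. -/
def futuresPrice {Ω : Type*} {mΩ : MeasurableSpace Ω} (P : Measure Ω) (ℱ : Filtration ℝ≥0 mΩ)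
    (E : ℝ≥0 → Ω → ℝ) (T₁ T₂ t : ℝ≥0) : Ω → ℝ :=
  P[futuresPayoff E T₁ T₂ | ℱ t]

end

/-! Variation of constants gives, for `t ≤ u`, `Y_i(u) = exp(-λ_i (u - t)) Y_i(t) + ∫_{(t,u]}
exp(-λ_i (u - s)) σ_i(s) dL_i(s)`. Multiplying by `Λ_i(u)`, integrating over `(a, b]` with `t ≤ a`
and exchanging the integrals splits `∫ E` into multiples of the `Y_i(t)`, known at time `t`, and
integrals over `(t, b]` of deterministic weights against `dL_i`, which are independent of `ℱ t`.
Conditioning keeps the former and replaces the latter by their means. For `t ≤ T₁` this is applied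
with `a = T₁`; for `t ≥ T₁` the integral up to `t` is already known and the rest is the case `a =
t`.

Since the paths are increasing, every stochastic integral is a Lebesgue–Stieltjes integral, so the
analysis (`ou_explicit`, `ou_restart`, `integral_mul_noise`) is carried out for a fixed locally
finite measure `μ` in place of `dL`.

Two probabilistic facts remain. The mean of `∫ h dL` is `(∫ z ν(dz)) ∫ h ds`
(`IsIncreasingPureJumpLevy.integrable_and_integral`): a pure jump path has a purely atomic Stieltjes
measure, so its jump measure can be recovered from it and the assumed intensity yields the mean of
every increment. The increments of `L i` after `t` are independent of `ℱ t`
(`indep_increments_generatedFiltration`): they are independent of the past of `L i`, and the other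
processes are independent of all of `L i`. -/

noncomputable section

/-! ### Increasing pure jump paths and their Stieltjes measures -/

section Path

variable {f : ℝ≥0 → ℝ}

lemma rightLim_comp_toNNReal (hrc : ∀ t, ContinuousWithinAt f (Ici t) t) (x : ℝ) :
    Function.rightLim (fun x : ℝ => f x.toNNReal) x = f x.toNNReal :=
  ContinuousWithinAt.rightLim_eq <|
    (hrc x.toNNReal).comp continuous_real_toNNReal.continuousWithinAt
      fun _ hz => Real.toNNReal_mono hz

lemma pathStieltjes_Ioc (hf : Monotone f) (hrc : ∀ t, ContinuousWithinAt f (Ici t) t) (a b : ℝ) :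
    pathStieltjes f (Ioc a b) = ENNReal.ofReal (f b.toNNReal - f a.toNNReal) := by
  rw [pathStieltjes, dif_pos hf, StieltjesFunction.measure_Ioc]
  simp only [Monotone.stieltjesFunction_eq, rightLim_comp_toNNReal hrc]

instance (f : ℝ≥0 → ℝ) : IsLocallyFiniteMeasure (pathStieltjes f) := by
  unfold pathStieltjes
  split_ifs <;> infer_instance

instance (f : ℝ≥0 → ℝ) (a b : ℝ) : IsFiniteMeasure ((pathStieltjes f).restrict (Ioc a b)) :=
  ⟨by simpa using measure_Ioc_lt_top⟩

lemma pathJump_nonneg (hf : Monotone f) (s : ℝ≥0) : 0 ≤ pathJump f s :=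
  sub_nonneg.2 (hf.leftLim_le le_rfl)

lemma pathStieltjes_singleton (hf : Monotone f) (hrc : ∀ t, ContinuousWithinAt f (Ici t) t)
    {s : ℝ≥0} (hs : 0 < s) :
    pathStieltjes f {(s : ℝ)} = ENNReal.ofReal (pathJump f s) := by
  have hs' : (0 : ℝ) < s := by exact_mod_cast hs
  rw [pathStieltjes, dif_pos hf, StieltjesFunction.measure_singleton]
  have h1 : Tendsto (fun x : ℝ => f x.toNNReal) (𝓝[<] (s : ℝ)) (𝓝 (Function.leftLim f s)) := by
    refine (hf.tendsto_leftLim s).comp ?_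
    refine tendsto_nhdsWithin_iff.2 ⟨?_, ?_⟩
    · have := continuous_real_toNNReal.tendsto (s : ℝ)
      rw [Real.toNNReal_coe] at this
      exact this.mono_left nhdsWithin_le_nhds
    · filter_upwards [Ioo_mem_nhdsLT hs'] with x hx
      exact (Real.toNNReal_lt_iff_lt_coe hx.1.le).2 hx.2
  have h2 : Function.leftLim (fun x : ℝ => f x.toNNReal) (s : ℝ) = Function.leftLim f s :=
    leftLim_eq_of_tendsto h1
  have h3 : ∀ h : Monotone fun x : ℝ => f x.toNNReal,
      (h.stieltjesFunction : ℝ → ℝ) = fun x : ℝ => f x.toNNReal := fun h =>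
    funext fun x => by rw [Monotone.stieltjesFunction_eq, rightLim_comp_toNNReal hrc]
  rw [h3, h2]
  simp only [Real.toNNReal_coe]
  rfl

/-- If a path is the sum of its jumps, then integrals against the path are sums over jumps. -/
lemma setLIntegral_pathStieltjes_eq_tsum (hf : Monotone f)
    (hrc : ∀ t, ContinuousWithinAt f (Ici t) t)
    (hpj : ∀ t : ℝ≥0, HasSum (fun s : Ioc 0 t => pathJump f s) (f t)) (h : ℝ → ℝ≥0∞)
    (c d : ℝ≥0) :
    ∫⁻ s in Ioc (c : ℝ) d, h s ∂(pathStieltjes f)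
      = ∑' s : Ioc c d, h (s : ℝ≥0) * ENNReal.ofReal (pathJump f s) := by
  set μ := pathStieltjes f with hμ
  have hf0 : f 0 = 0 := by
    have := hpj 0
    have he : IsEmpty (Ioc (0 : ℝ≥0) 0) := by simp
    exact this.unique hasSum_empty
  -- the set of jump times
  let J : Set ℝ≥0 := {s | s ∈ Ioc 0 d ∧ pathJump f s ≠ 0}
  have hJc : J.Countable := by
    have h1 := (hpj d).summable.countable_support
    have h2 : J ⊆ Subtype.val '' (Function.support fun s : Ioc 0 d => pathJump f s) := by
      rintro s ⟨hs, hs'⟩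
      exact ⟨⟨s, hs⟩, hs', rfl⟩
    exact (h1.image _).mono h2
  have sum_eq : ∀ (c : ℝ≥0) (g : ℝ → ℝ≥0∞),
      ∫⁻ s in (fun s : ℝ≥0 => (s : ℝ)) '' (J ∩ Ioc c d), g s ∂μ
        = ∑' s : Ioc c d, g (s : ℝ≥0) * ENNReal.ofReal (pathJump f s) := by
    intro c g
    rw [lintegral_countable _ ((hJc.mono inter_subset_left).image _),
      tsum_image (fun a => g a * μ {a}) NNReal.coe_injective.injOn,
      tsum_subtype (J ∩ Ioc c d) (fun s : ℝ≥0 => g s * μ {(s : ℝ)}),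
      tsum_subtype (Ioc c d) (fun s : ℝ≥0 => g s * ENNReal.ofReal (pathJump f s))]
    refine tsum_congr fun s => ?_
    by_cases hs : s ∈ Ioc c d
    · have hs0 : 0 < s := lt_of_le_of_lt zero_le hs.1
      by_cases hj : pathJump f s = 0
      · rw [indicator_of_notMem (fun h => h.1.2 hj), indicator_of_mem hs]
        simp [hj]
      · rw [indicator_of_mem (show s ∈ J ∩ Ioc c d from ⟨⟨⟨hs0, hs.2⟩, hj⟩, hs⟩), indicator_of_mem hs,
          pathStieltjes_singleton hf hrc hs0]
    · rw [indicator_of_notMem (fun h => hs h.2), indicator_of_notMem hs]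
  have hS : ∀ c : ℝ≥0, MeasurableSet ((fun s : ℝ≥0 => (s : ℝ)) '' (J ∩ Ioc c d)) := fun c =>
    ((hJc.mono inter_subset_left).image _).measurableSet
  have hsub : ∀ c : ℝ≥0, (fun s : ℝ≥0 => (s : ℝ)) '' (J ∩ Ioc c d) ⊆ Ioc (c : ℝ) d := by
    rintro c _ ⟨s, hs, rfl⟩
    exact ⟨by exact_mod_cast hs.2.1, by exact_mod_cast hs.2.2⟩
  -- The atoms at the jump times have total mass `f d`, which is already the mass of `(0, d]`;
  -- nothing is left off the jump times.
  have hnull : μ (Ioc (0 : ℝ) d \ (fun s : ℝ≥0 => (s : ℝ)) '' (J ∩ Ioc 0 d)) = 0 := by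
    have h1 : μ ((fun s : ℝ≥0 => (s : ℝ)) '' (J ∩ Ioc 0 d)) = ENNReal.ofReal (f d) := by
      have := sum_eq 0 1
      simp only [Pi.one_apply, lintegral_one, Measure.restrict_apply_univ, one_mul] at this
      rw [this, ← ENNReal.ofReal_tsum_of_nonneg (fun s : Ioc 0 d => pathJump_nonneg hf s)
        (hpj d).summable, (hpj d).tsum_eq]
    have hsub0 := hsub 0
    rw [NNReal.coe_zero] at hsub0
    rw [measure_sdiff hsub0 (hS 0).nullMeasurableSet (by rw [h1]; simp), h1,
      hμ, pathStieltjes_Ioc hf hrc]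
    simp [hf0]
  rw [← sum_eq c h]
  refine (setLIntegral_congr ?_).symm
  refine (ae_eq_set.2 ⟨?_, ?_⟩)
  · rw [sdiff_eq_empty.2 (hsub c)]; simp
  · refine measure_mono_null ?_ hnull
    rintro x ⟨hx, hx'⟩
    have hx0 : (0 : ℝ) < x := lt_of_le_of_lt c.2 hx.1
    refine ⟨⟨hx0, hx.2⟩, ?_⟩
    rintro ⟨s, hs, rfl⟩
    exact hx' ⟨s, ⟨hs.1, by exact_mod_cast hx.1, by exact_mod_cast hx.2⟩, rfl⟩

/-- The jumps in `(c, d]` of sizes in `A`, counted through the Lebesgue–Stieltjes measure. -/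
lemma jumpMeasure_Ioc_prod (hf : Monotone f)
    (hrc : ∀ t, ContinuousWithinAt f (Ici t) t)
    (hpj : ∀ t : ℝ≥0, HasSum (fun s : Ioc 0 t => pathJump f s) (f t))
    (c d : ℝ≥0) {A : Set ℝ} (hA : MeasurableSet A) :
    jumpMeasure f (Ioc c d ×ˢ A) = ∫⁻ s in Ioc (c : ℝ) d,
      A.indicator (fun z => (ENNReal.ofReal z)⁻¹) (pathStieltjes f {s}).toReal
        ∂(pathStieltjes f) := by
  -- The atom at a jump of size `z` has mass `z`, so the weight `1 / z` makes it count once. The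
  -- jump size is read off as the mass of `{s}`.
  rw [setLIntegral_pathStieltjes_eq_tsum hf hrc hpj, jumpMeasure,
    Measure.sum_apply _ (measurableSet_Ioc.prod hA),
    show ∑' i : {s : ℝ≥0 // pathJump f s ≠ 0}, Measure.dirac (i.1, pathJump f i.1) (Ioc c d ×ˢ A)
      = _ from tsum_subtype {s : ℝ≥0 | pathJump f s ≠ 0}
        (fun s => Measure.dirac (s, pathJump f s) (Ioc c d ×ˢ A)),
    tsum_subtype (Ioc c d) (fun s : ℝ≥0 => A.indicator (fun z => (ENNReal.ofReal z)⁻¹)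
      (pathStieltjes f {(s : ℝ)}).toReal * ENNReal.ofReal (pathJump f s))]
  refine tsum_congr fun s => ?_
  have hJ := pathJump_nonneg hf s
  by_cases hs : s ∈ Ioc c d
  · have hs0 : 0 < s := lt_of_le_of_lt zero_le hs.1
    rw [indicator_of_mem hs, pathStieltjes_singleton hf hrc hs0, ENNReal.toReal_ofReal hJ]
    by_cases hj : pathJump f s = 0
    · rw [indicator_of_notMem (by simpa using hj), hj]; simp
    · rw [indicator_of_mem (by simpa using hj),
        Measure.dirac_apply' _ (measurableSet_Ioc.prod hA)]
      by_cases hz : pathJump f s ∈ A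
      · rw [indicator_of_mem (mk_mem_prod hs hz), indicator_of_mem hz, ENNReal.inv_mul_cancel]
        · rfl
        · simpa using lt_of_le_of_ne hJ (Ne.symm hj)
        · simp
      · rw [indicator_of_notMem (fun h => hz h.2), indicator_of_notMem hz, zero_mul]
  · rw [indicator_of_notMem hs]
    refine indicator_apply_eq_zero.2 fun _ => ?_
    rw [Measure.dirac_apply' _ (measurableSet_Ioc.prod hA), indicator_of_notMem fun h => hs h.1]

end Path

/-! ### Measurable dependence of the path measure on `ω` -/

section Random

variable {Ω : Type*} {L : ℝ≥0 → Ω → ℝ}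

/-- Intervals form a π-system generating the Borel sets, and their masses are increments of the
path. Only increments inside `(a, b]` enter, so `m` may be a σ-algebra of the past or of the future.
-/
lemma measurable_pathStieltjes_restrict {m : MeasurableSpace Ω}
    (hmono : ∀ ω, Monotone fun t => L t ω)
    (hrc : ∀ ω t, ContinuousWithinAt (fun s => L s ω) (Ici t) t) {a b : ℝ≥0}
    (hmeas : ∀ c d : ℝ≥0, a ≤ c → c ≤ d → d ≤ b → Measurable fun ω => L d ω - L c ω) :
    Measurable fun ω => (pathStieltjes fun r => L r ω).restrict (Ioc (a : ℝ) b) := by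
  have key : ∀ c d : ℝ, (a : ℝ) ≤ c → d ≤ b →
      Measurable fun ω => pathStieltjes (fun r => L r ω) (Ioc c d) := by
    intro c d hac hdb
    rcases le_or_gt c d with hcd | hcd
    · simp only [pathStieltjes_Ioc (hmono _) (hrc _)]
      refine (hmeas _ _ ?_ (Real.toNNReal_mono hcd) ?_).ennreal_ofReal
      · exact NNReal.le_toNNReal_of_coe_le hac
      · exact Real.toNNReal_le_iff_le_coe.2 hdb
    · simp [Ioc_eq_empty_of_le hcd.le]
  refine Measurable.measure_of_isPiSystem (S := {S : Set ℝ | ∃ l u, l < u ∧ Ioc l u = S})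
    ?_ ?_ ?_ ?_
  · rw [← borel_eq_generateFrom_Ioc]; exact BorelSpace.measurable_eq
  · exact isPiSystem_Ioc id id
  · rintro _ ⟨l, u, _, rfl⟩
    simp only [Measure.restrict_apply measurableSet_Ioc, Ioc_inter_Ioc]
    exact key _ _ le_sup_right inf_le_right
  · simp only [Measure.restrict_apply MeasurableSet.univ, univ_inter]
    exact key _ _ le_rfl le_rfl

end Random

/-- Dividing by `1 + κ a univ` gives a kernel of mass at most `1`, from which `κ` is recovered by a
finite density. This serves path measures, which are finite for each `ω` without a uniform bound. -/
lemma isSFiniteKernel_of_isFiniteMeasure {α β : Type*} {mα : MeasurableSpace α}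
    {mβ : MeasurableSpace β} (κ : Kernel α β) [∀ a, IsFiniteMeasure (κ a)] :
    IsSFiniteKernel κ := by
  have hm : Measurable fun a => κ a univ := κ.measurable_coe MeasurableSet.univ
  let η : Kernel α β :=
    { toFun := fun a => (1 + κ a univ)⁻¹ • κ a
      measurable' := by
        refine Measure.measurable_of_measurable_coe _ fun s hs => ?_
        simp only [Measure.smul_apply, smul_eq_mul]
        exact (measurable_const.add hm).inv.mul (κ.measurable_coe hs) }
  have hη : ∀ a, η a = (1 + κ a univ)⁻¹ • κ a := fun _ => rfl
  have hfin : IsFiniteKernel η := by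
    refine ⟨1, ENNReal.one_lt_top, fun a => ?_⟩
    rw [hη, Measure.smul_apply, smul_eq_mul, mul_comm, ← div_eq_mul_inv]
    exact ENNReal.div_le_of_le_mul (by rw [one_mul]; exact le_add_self)
  have hmeas : Measurable (Function.uncurry fun (a : α) (_ : β) => 1 + κ a univ) :=
    (measurable_const.add hm).comp measurable_fst
  have : κ = Kernel.withDensity η (fun a _ => 1 + κ a univ) := by
    ext a : 1
    rw [Kernel.withDensity_apply _ hmeas, withDensity_const, hη, smul_smul,
      ENNReal.mul_inv_cancel (by simp) (by simp), one_smul]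
  rw [this]
  exact Kernel.IsSFiniteKernel.withDensity η fun a _ => by simp

/-! ### Means of integrals against the paths -/

section Mean

variable {Ω : Type*} {mΩ : MeasurableSpace Ω} {P : Measure Ω} [IsProbabilityMeasure P]
  {L : ℝ≥0 → Ω → ℝ} {ν : Measure ℝ}

/-- The increment is the sum of the jumps in `(c, d]`. The image of `P ⊗ₘ κ` under the jump size `G`
weights each jump by its size; dividing by the size gives the mean number of jumps, that is `(d - c)
ν`, and integrating `z` against it gives back the mean increment. -/
lemma IsIncreasingPureJumpLevy.lintegral_sub (hL : IsIncreasingPureJumpLevy L ν P) {c d : ℝ≥0}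
    (hcd : c ≤ d) :
    ∫⁻ ω, ENNReal.ofReal (L d ω - L c ω) ∂P
      = ((d - c : ℝ≥0) : ℝ≥0∞) * ∫⁻ z, ENNReal.ofReal z ∂ν := by
  let μ : Ω → Measure ℝ := fun ω => pathStieltjes fun r => L r ω
  let κ : Kernel Ω ℝ := ⟨fun ω => (μ ω).restrict (Ioc (c : ℝ) d),
    measurable_pathStieltjes_restrict hL.monotone_paths hL.right_continuous
      fun c d _ _ _ => (hL.measurable d).sub (hL.measurable c)⟩
  have hκ : ∀ ω, κ ω = (μ ω).restrict (Ioc (c : ℝ) d) := fun _ => rfl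
  have hκfin : ∀ ω, IsFiniteMeasure (κ ω) := fun ω => by rw [hκ]; infer_instance
  have hsf : IsSFiniteKernel κ := isSFiniteKernel_of_isFiniteMeasure κ
  let G : Ω × ℝ → ℝ := fun p => (κ p.1 {p.2}).toReal
  have hG : Measurable G := by
    -- The set `{s}` is a section of the diagonal, which makes its mass jointly measurable in `(ω,
    -- s)`.
    have := Kernel.measurable_kernel_prodMk_left (κ := Kernel.prodMkRight ℝ κ)
      (t := {q : (Ω × ℝ) × ℝ | q.2 = q.1.2})
      (measurableSet_eq_fun measurable_snd (measurable_snd.comp measurable_fst))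
    exact this.ennreal_toReal
  have hGμ : ∀ ω, ∀ s ∈ Ioc (c : ℝ) d, G (ω, s) = (μ ω {s}).toReal := by
    intro ω s hs
    simp only [G, hκ]
    rw [Measure.restrict_apply (measurableSet_singleton s), inter_eq_left.2 (by simpa using hs)]
  have hint : ∀ h : ℝ → ℝ≥0∞, Measurable h →
      ∫⁻ z, h z ∂((P ⊗ₘ κ).map G)
        = ∫⁻ ω, ∫⁻ s in Ioc (c : ℝ) d, h (μ ω {s}).toReal ∂(μ ω) ∂P := by
    intro h hh
    rw [lintegral_map hh hG, Measure.lintegral_compProd (f := fun p => h (G p)) (hh.comp hG)]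
    refine lintegral_congr fun ω => ?_
    rw [hκ]
    exact setLIntegral_congr_fun measurableSet_Ioc fun s hs => by simp only [hGμ ω s hs]
  have hinv : Measurable fun z : ℝ => (ENNReal.ofReal z)⁻¹ := ENNReal.measurable_ofReal.inv
  have hν : ((P ⊗ₘ κ).map G).withDensity (fun z => (ENNReal.ofReal z)⁻¹)
      = ((d - c : ℝ≥0) : ℝ≥0∞) • ν := by
    ext A hA
    rw [withDensity_apply _ hA, ← lintegral_indicator hA, hint _ (hinv.indicator hA),
      Measure.smul_apply, smul_eq_mul, ← hL.jump_intensity c d hcd A hA]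
    refine lintegral_congr fun ω => ?_
    rw [jumpMeasure_Ioc_prod (hL.monotone_paths ω) (hL.right_continuous ω) (hL.pure_jump ω) c d hA]
  rw [← smul_eq_mul, ← lintegral_smul_measure, ← hν,
    lintegral_withDensity_eq_lintegral_mul _ hinv ENNReal.measurable_ofReal,
    hint _ (hinv.mul ENNReal.measurable_ofReal)]
  refine lintegral_congr fun ω => ?_
  have hmono := hL.monotone_paths ω
  have hrc := hL.right_continuous ω
  have h1 : ENNReal.ofReal (L d ω - L c ω) = ∫⁻ s in Ioc (c : ℝ) d, 1 ∂(μ ω) := by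
    rw [setLIntegral_one, pathStieltjes_Ioc hmono hrc]
    simp
  -- The integrands `1` and `z⁻¹ * z` differ where `z = 0`, but as sums over jumps both give such
  -- points the weight `0`.
  rw [h1, setLIntegral_pathStieltjes_eq_tsum hmono hrc (hL.pure_jump ω),
    setLIntegral_pathStieltjes_eq_tsum hmono hrc (hL.pure_jump ω)]
  refine tsum_congr fun s => ?_
  have hs0 : 0 < s.1 := lt_of_le_of_lt zero_le s.2.1
  have hJ := pathJump_nonneg hmono s.1
  simp only [μ, Pi.mul_apply]
  rw [pathStieltjes_singleton hmono hrc hs0, ENNReal.toReal_ofReal hJ]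
  rcases hJ.eq_or_lt with hj | hj
  · simp [← hj]
  · rw [ENNReal.inv_mul_cancel (by simpa using hj) (by simp)]

/-- Integrals of deterministic functions against the paths have mean `(∫ z ν(dz)) ∫ h(s) ds`. -/
lemma IsIncreasingPureJumpLevy.lintegral_lintegral (hL : IsIncreasingPureJumpLevy L ν P)
    (hν : ∫⁻ z, ENNReal.ofReal z ∂ν ≠ ∞) (a b : ℝ≥0) {h : ℝ → ℝ≥0∞} (hh : Measurable h) :
    ∫⁻ ω, ∫⁻ s in Ioc (a : ℝ) b, h s ∂(pathStieltjes fun r => L r ω) ∂P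
      = (∫⁻ z, ENNReal.ofReal z ∂ν) * ∫⁻ s in Ioc (a : ℝ) b, h s := by
  have hmeas : Measurable fun ω => (pathStieltjes fun r => L r ω).restrict (Ioc (a : ℝ) b) :=
    measurable_pathStieltjes_restrict hL.monotone_paths hL.right_continuous
      fun c d _ _ _ => (hL.measurable d).sub (hL.measurable c)
  rw [← Measure.lintegral_bind hmeas.aemeasurable hh.aemeasurable, ← smul_eq_mul,
    ← lintegral_smul_measure]
  -- It suffices to identify the mean of the path measures with a multiple of Lebesgue measure on
  -- `(a, b]`. The two agree on intervals by `lintegral_sub`, and `hν` provides the finiteness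
  -- needed to extend from a π-system.
  congr 1
  set M := ∫⁻ z, ENNReal.ofReal z ∂ν with hM
  have key : ∀ c d : ℝ, (a : ℝ) ≤ c → d ≤ b →
      ∫⁻ ω, pathStieltjes (fun r => L r ω) (Ioc c d) ∂P = M * volume (Ioc c d) := by
    intro c d hac hdb
    rcases le_or_gt c d with hcd | hcd
    · simp only [pathStieltjes_Ioc (hL.monotone_paths _) (hL.right_continuous _)]
      rw [hL.lintegral_sub (Real.toNNReal_mono hcd), mul_comm, Real.volume_Ioc, ENNReal.ofReal]
      congr 2
      have hc : 0 ≤ c := a.2.trans hac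
      ext
      rw [NNReal.coe_sub (Real.toNNReal_mono hcd), Real.coe_toNNReal _ (hc.trans hcd),
        Real.coe_toNNReal _ hc, Real.coe_toNNReal _ (sub_nonneg.2 hcd)]
    · simp [Ioc_eq_empty_of_le hcd.le]
  have hfin : IsFiniteMeasure (Measure.bind P fun ω =>
      (pathStieltjes fun r => L r ω).restrict (Ioc (a : ℝ) b)) := by
    refine ⟨?_⟩
    rw [Measure.bind_apply MeasurableSet.univ hmeas.aemeasurable]
    simp only [Measure.restrict_apply_univ]
    rw [key _ _ le_rfl le_rfl, Real.volume_Ioc]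
    exact ENNReal.mul_lt_top hν.lt_top ENNReal.ofReal_lt_top
  refine ext_of_generate_finite {S : Set ℝ | ∃ l u, l < u ∧ Ioc l u = S}
    (by rw [← borel_eq_generateFrom_Ioc]; exact BorelSpace.measurable_eq)
    (isPiSystem_Ioc id id) ?_ ?_
  · rintro _ ⟨l, u, _, rfl⟩
    rw [Measure.bind_apply measurableSet_Ioc hmeas.aemeasurable]
    simp only [Measure.smul_apply, Measure.restrict_apply measurableSet_Ioc, Ioc_inter_Ioc,
      smul_eq_mul]
    exact key _ _ le_sup_right inf_le_right
  · rw [Measure.bind_apply MeasurableSet.univ hmeas.aemeasurable]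
    simp only [Measure.smul_apply, Measure.restrict_apply_univ, smul_eq_mul]
    exact key _ _ le_rfl le_rfl

/-- The path integral of a deterministic function over `(a, b]` is measurable with respect to any
`σ`-algebra for which the increments over subintervals of `(a, b]` are measurable. -/
lemma stronglyMeasurable_integral_pathStieltjes {m : MeasurableSpace Ω}
    (hmono : ∀ ω, Monotone fun t => L t ω)
    (hrc : ∀ ω t, ContinuousWithinAt (fun s => L s ω) (Ici t) t) {a b : ℝ≥0}
    (hmeas : ∀ c d : ℝ≥0, a ≤ c → c ≤ d → d ≤ b → Measurable[m] fun ω => L d ω - L c ω)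
    {h : ℝ → ℝ} (hh : Measurable h) (hpos : ∀ s ∈ Ioc (a : ℝ) b, 0 ≤ h s) :
    StronglyMeasurable[m]
      fun ω => ∫ s in Ioc (a : ℝ) b, h s ∂(pathStieltjes fun r => L r ω) := by
  have h1 := measurable_pathStieltjes_restrict hmono hrc hmeas
  simp only [integral_eq_lintegral_of_nonneg_ae
    (ae_restrict_of_forall_mem measurableSet_Ioc hpos) hh.aestronglyMeasurable]
  exact ((Measure.measurable_lintegral hh.ennreal_ofReal).comp h1).ennreal_toReal.stronglyMeasurable

lemma IsIncreasingPureJumpLevy.integrable_and_integral (hL : IsIncreasingPureJumpLevy L ν P)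
    (hν : IntegrableOn (fun z : ℝ => z) (Ioi 0) ν) (a b : ℝ≥0)
    {h : ℝ → ℝ} (hh : Measurable h) (hpos : ∀ s ∈ Ioc (a : ℝ) b, 0 ≤ h s) {C : ℝ} (hC : ∀ s ∈ Ioc (a : ℝ) b, h s ≤ C) :
    Integrable (fun ω => ∫ s in Ioc (a : ℝ) b, h s ∂(pathStieltjes fun r => L r ω)) P ∧
    ∫ ω, ∫ s in Ioc (a : ℝ) b, h s ∂(pathStieltjes fun r => L r ω) ∂P
      = (∫ z in Ioi 0, z ∂ν) * ∫ s in Ioc (a : ℝ) b, h s := by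
  -- `ENNReal.ofReal` vanishes on `z ≤ 0`, so only the restriction of `ν` to `(0, ∞)` matters.
  have hM : ∫⁻ z, ENNReal.ofReal z ∂ν = ENNReal.ofReal (∫ z in Ioi 0, z ∂ν) := by
    rw [ofReal_integral_eq_lintegral_ofReal hν
      ((ae_restrict_mem measurableSet_Ioi).mono fun z hz => le_of_lt hz),
      ← lintegral_indicator measurableSet_Ioi]
    refine lintegral_congr fun z => ?_
    by_cases hz : z ∈ Ioi (0 : ℝ)
    · rw [indicator_of_mem hz]
    · rw [indicator_of_notMem hz, ENNReal.ofReal_of_nonpos (by simpa using hz)]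
  have hM0 : 0 ≤ ∫ z in Ioi 0, z ∂ν :=
    setIntegral_nonneg measurableSet_Ioi fun z hz => le_of_lt hz
  have hae : ∀ μ : Measure ℝ, 0 ≤ᵐ[μ.restrict (Ioc (a : ℝ) b)] h := fun μ =>
    ae_restrict_of_forall_mem measurableSet_Ioc hpos
  have hint : ∀ (μ : Measure ℝ) [IsLocallyFiniteMeasure μ],
      Integrable h (μ.restrict (Ioc (a : ℝ) b)) := fun μ _ =>
    have : IsFiniteMeasure (μ.restrict (Ioc (a : ℝ) b)) := ⟨by simpa using measure_Ioc_lt_top⟩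
    Integrable.of_bound hh.aestronglyMeasurable C
      (ae_restrict_of_forall_mem measurableSet_Ioc fun s hs => by
        rw [Real.norm_of_nonneg (hpos s hs)]; exact hC s hs)
  have hsm : StronglyMeasurable
      fun ω => ∫ s in Ioc (a : ℝ) b, h s ∂(pathStieltjes fun r => L r ω) :=
    stronglyMeasurable_integral_pathStieltjes hL.monotone_paths hL.right_continuous
      (fun c d _ _ _ => (hL.measurable d).sub (hL.measurable c)) hh hpos
  have hnn : ∀ ω, 0 ≤ ∫ s in Ioc (a : ℝ) b, h s ∂(pathStieltjes fun r => L r ω) := fun ω =>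
    setIntegral_nonneg measurableSet_Ioc hpos
  have key : ∫⁻ ω, ENNReal.ofReal
        (∫ s in Ioc (a : ℝ) b, h s ∂(pathStieltjes fun r => L r ω)) ∂P
      = ENNReal.ofReal ((∫ z in Ioi 0, z ∂ν) * ∫ s in Ioc (a : ℝ) b, h s) := by
    simp only [ofReal_integral_eq_lintegral_ofReal (hint _) (hae _)]
    rw [hL.lintegral_lintegral (by rw [hM]; simp) a b hh.ennreal_ofReal, hM,
      ← ofReal_integral_eq_lintegral_ofReal (hint _) (hae _),
      ENNReal.ofReal_mul hM0]
  refine ⟨⟨hsm.aestronglyMeasurable, ?_⟩, ?_⟩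
  · rw [hasFiniteIntegral_iff_ofReal (ae_of_all _ hnn), key]
    exact ENNReal.ofReal_lt_top
  · rw [integral_eq_lintegral_of_nonneg_ae (ae_of_all _ hnn) hsm.aestronglyMeasurable, key,
      ENNReal.toReal_ofReal (mul_nonneg hM0 (setIntegral_nonneg measurableSet_Ioc hpos))]

end Mean

/-! ### Independence of future increments from the generated filtration -/

lemma comap_pi_le {Ω ι : Type*} {m : MeasurableSpace Ω} {f : ι → Ω → ℝ}
    (hf : ∀ i, Measurable (f i)) :
    MeasurableSpace.comap (fun ω i => f i ω) inferInstance ≤ m :=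
  (measurable_pi_lambda _ hf).comap_le

section Independence

variable {Ω : Type*} {mΩ : MeasurableSpace Ω} {P : Measure Ω}

/-- The sequence enumerates `F ∪ {0}` in increasing order and then stays constant. It lets finitely
many times be treated by independence of the increments along one sequence. -/
lemma exists_monotone_seq_range_superset (F : Finset ℝ≥0) :
    ∃ τ : ℕ → ℝ≥0, Monotone τ ∧ τ 0 = 0 ∧ ∀ s ∈ F, ∃ k, τ k = s := by
  have hpos : 0 < (insert 0 F).card := Finset.card_pos.2 ⟨0, Finset.mem_insert_self _ _⟩
  let e := (insert 0 F).orderEmbOfFin rfl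
  refine ⟨fun k => e ⟨min k ((insert 0 F).card - 1), by omega⟩, ?_, ?_, ?_⟩
  · intro a b hab
    exact e.monotone (Fin.mk_le_mk.2 (min_le_min_right _ hab))
  · have : (⟨min 0 ((insert 0 F).card - 1), by omega⟩ : Fin (insert 0 F).card) = ⟨0, hpos⟩ := by
      simp
    simp only [this, e]
    rw [Finset.orderEmbOfFin_zero rfl hpos]
    exact le_antisymm (Finset.min'_le _ _ (Finset.mem_insert_self _ _)) zero_le
  · intro s hs
    have : s ∈ Set.range e := by
      rw [Finset.range_orderEmbOfFin]
      exact_mod_cast Finset.mem_insert_of_mem hs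
    obtain ⟨k, rfl⟩ := this
    refine ⟨k, ?_⟩
    exact congrArg e (Fin.ext (min_eq_left (Nat.le_sub_one_of_lt k.2)))

/-- For a process started at `0` with independent increments, the increments after time `t` are
jointly independent of the process up to time `t`. -/
lemma HasIndepIncrements.indepFun_past_future [IsProbabilityMeasure P] {X : ℝ≥0 → Ω → ℝ}
    (hX : HasIndepIncrements X P) (hmeas : ∀ t, Measurable (X t)) (h0 : ∀ ω, X 0 ω = 0)
    (t : ℝ≥0) :
    IndepFun (fun ω (s : Iic t) => X s ω) (fun ω (s : Ici t) => X s ω - X t ω) P := by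
  refine IndepFun.process_indepFun_process (fun s => hmeas s)
    (fun s => (hmeas s).sub (hmeas t)) fun I J => ?_
  obtain ⟨τ, hτ, hτ0, hτF⟩ := exists_monotone_seq_range_superset
    (insert t (I.image Subtype.val ∪ J.image Subtype.val))
  obtain ⟨k₀, hk₀⟩ := hτF t (Finset.mem_insert_self _ _)
  let inc : ℕ → Ω → ℝ := fun j ω => X (τ (j + 1)) ω - X (τ j) ω
  have hinc : ∀ j, Measurable (inc j) := fun j => (hmeas _).sub (hmeas _)
  -- With `τ k₀ = t`, past values are sums of increments with index below `k₀`, and future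
  -- increments are sums over indices from `k₀` on.
  have hind := indep_iSup_of_disjoint (fun j => (hinc j).comap_le) (hX.nat hτ).iIndep
    (S := Iio k₀) (T := Ici k₀) (by
      rw [Set.disjoint_left]; intro a ha hb; exact absurd (mem_Iio.1 ha) (not_lt.2 hb))
  have hm : ∀ (S : Set ℕ) (j : ℕ), j ∈ S →
      Measurable[⨆ j ∈ S, MeasurableSpace.comap (inc j) inferInstance] (inc j) := fun S j hj =>
    (comap_measurable (inc j)).mono
      (le_iSup₂ (f := fun j (_ : j ∈ S) => MeasurableSpace.comap (inc j) inferInstance) j hj) le_rfl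
  rw [IndepFun_iff_Indep]
  refine indep_of_indep_of_le hind ?_ ?_
  · refine comap_pi_le fun i => ?_
    obtain ⟨k, hk⟩ := hτF i.1.1 (by
      simp only [Finset.mem_insert, Finset.mem_union, Finset.mem_image]
      exact Or.inr (Or.inl ⟨i.1, i.2, rfl⟩))
    -- As `τ` is not injective, `τ k ≤ t` does not force `k ≤ k₀`; truncating the index does not
    -- change the value.
    have hk' : τ (min k k₀) = i.1.1 := by
      rw [hτ.map_min, hk, hk₀]
      exact min_eq_left i.1.2
    have hsum : X i.1.1 = fun ω => ∑ j ∈ Finset.range (min k k₀), inc j ω := by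
      ext ω
      rw [Finset.sum_range_sub (fun j => X (τ j) ω), hk', hτ0, h0, sub_zero]
    rw [hsum]
    refine Finset.measurable_fun_sum _ fun j hj => hm _ j ?_
    exact lt_of_lt_of_le (Finset.mem_range.1 hj) (min_le_right _ _)
  · refine comap_pi_le fun i => ?_
    obtain ⟨k, hk⟩ := hτF i.1.1 (by
      simp only [Finset.mem_insert, Finset.mem_union, Finset.mem_image]
      exact Or.inr (Or.inr ⟨i.1, i.2, rfl⟩))
    have hk' : τ (max k k₀) = i.1.1 := by
      rw [hτ.map_max, hk, hk₀]
      exact max_eq_left i.1.2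
    have hsum : (fun ω => X i.1.1 ω - X t ω)
        = fun ω => ∑ j ∈ Finset.Ico k₀ (max k k₀), inc j ω := by
      ext ω
      rw [Finset.sum_Ico_sub (fun j => X (τ j) ω) (le_max_right _ _), hk', hk₀]
    rw [hsum]
    exact Finset.measurable_fun_sum _ fun j hj => hm _ j (Finset.mem_Ico.1 hj).1

/-- The sets `A ∩ B` with `A` in `m₂` and `B` in `m₃` form a π-system generating the supremum. For
`C` in `m₁`, the set `C ∩ A` lies in `m'`, so `B` factors out first and then `C` separates from `A`.
-/
lemma Indep.sup_right_of_le [IsZeroOrProbabilityMeasure P] {m₁ m₂ m₃ m' : MeasurableSpace Ω}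
    (h₁₂ : Indep m₁ m₂ P) (h₃ : Indep m' m₃ P) (h₁ : m₁ ≤ m') (h₂ : m₂ ≤ m') (hm' : m' ≤ mΩ)
    (hm₃ : m₃ ≤ mΩ) : Indep m₁ (m₂ ⊔ m₃) P := by
  let π : Set (Set Ω) := {s | ∃ A B, MeasurableSet[m₂] A ∧ MeasurableSet[m₃] B ∧ A ∩ B = s}
  have hπ : IsPiSystem π := by
    rintro _ ⟨A, B, hA, hB, rfl⟩ _ ⟨A', B', hA', hB', rfl⟩ _
    exact ⟨A ∩ A', B ∩ B', hA.inter hA', hB.inter hB', inter_inter_inter_comm _ _ _ _⟩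
  have hgen : m₂ ⊔ m₃ = MeasurableSpace.generateFrom π := by
    refine le_antisymm (sup_le ?_ ?_) (MeasurableSpace.generateFrom_le ?_)
    · intro A hA
      exact MeasurableSpace.measurableSet_generateFrom
        ⟨A, univ, hA, MeasurableSet.univ, inter_univ A⟩
    · intro B hB
      exact MeasurableSpace.measurableSet_generateFrom
        ⟨univ, B, MeasurableSet.univ, hB, univ_inter B⟩
    · rintro _ ⟨A, B, hA, hB, rfl⟩
      exact MeasurableSet.inter ((le_sup_left : m₂ ≤ m₂ ⊔ m₃) A hA)
        ((le_sup_right : m₃ ≤ m₂ ⊔ m₃) B hB)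
  refine IndepSets.indep (h₁.trans hm') (sup_le (h₂.trans hm') hm₃)
    (@MeasurableSpace.isPiSystem_measurableSet Ω m₁) hπ
    (@MeasurableSpace.generateFrom_measurableSet Ω m₁).symm hgen ?_
  rw [IndepSets_iff]
  rintro C _ hC ⟨A, B, hA, hB, rfl⟩
  rw [Indep_iff] at h₁₂ h₃
  rw [← inter_assoc, h₃ _ _ (MeasurableSet.inter (h₁ C hC) (h₂ A hA)) hB, h₁₂ C A hC hA,
    h₃ A B (h₂ A hA) hB, mul_assoc]

/-- The increments of `L i` after time `t` are independent of the filtration generated by all the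
independent processes `L j` up to time `t`. -/
lemma indep_increments_generatedFiltration [IsProbabilityMeasure P] {n : ℕ}
    {L : Fin n → ℝ≥0 → Ω → ℝ} (hmeas : ∀ i t, Measurable (L i t)) (h0 : ∀ i ω, L i 0 ω = 0)
    (hincr : ∀ i, HasIndepIncrements (L i) P) (hind : iIndepFun (fun i ω t => L i t ω) P)
    (i : Fin n) (t : ℝ≥0) :
    Indep (MeasurableSpace.comap (fun ω (s : Ici t) => L i s ω - L i t ω) inferInstance)
      (generatedFiltration L hmeas t) P := by
  let m : Fin n → MeasurableSpace Ω := fun j =>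
    MeasurableSpace.comap (fun ω t => L j t ω) inferInstance
  have hm : ∀ j, m j ≤ mΩ := fun j => (measurable_pi_lambda _ (hmeas j)).comap_le
  have hLm : ∀ j s, Measurable[m j] (L j s) := fun j s =>
    (measurable_pi_apply s).comp (comap_measurable fun ω t => L j t ω)
  have hpf := (HasIndepIncrements.indepFun_past_future (hincr i) (hmeas i) (h0 i) t).symm
  rw [IndepFun_iff_Indep] at hpf
  have hsplit := indep_iSup_of_disjoint hm hind.iIndep (S := {i}) (T := {i}ᶜ)
    disjoint_compl_right
  simp only [mem_singleton_iff, iSup_iSup_eq_left] at hsplit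
  -- Here `m₁` is the future of `L i`, `m₂` its past, `m'` the σ-algebra of the whole process `L i`,
  -- and `m₃` that of all the other processes.
  have hall := Indep.sup_right_of_le hpf hsplit
    (comap_pi_le fun s => (hLm i s).sub (hLm i t))
    (comap_pi_le fun s => hLm i s) (hm i)
    (iSup₂_le fun j _ => hm j)
  refine indep_of_indep_of_le_right hall (iSup₂_le fun s hs => comap_pi_le fun j => ?_)
  by_cases hj : j = i
  · subst hj
    exact Measurable.mono ((measurable_pi_apply (⟨s, hs⟩ : Iic t)).comp
      (comap_measurable fun ω (s : Iic t) => L j s ω)) le_sup_left le_rfl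
  · refine Measurable.mono (hLm j s) (le_trans ?_ le_sup_right) le_rfl
    exact le_iSup₂ (f := fun j (_ : j ∈ ({i}ᶜ : Set (Fin n))) => m j) j hj

lemma measurable_generatedFiltration {n : ℕ} {L : Fin n → ℝ≥0 → Ω → ℝ}
    (hmeas : ∀ i t, Measurable (L i t)) (i : Fin n) {s t : ℝ≥0} (hst : s ≤ t) :
    Measurable[generatedFiltration L hmeas t] (L i s) := by
  have h1 : Measurable[generatedFiltration L hmeas t] fun ω j => L j s ω :=
    (comap_measurable fun ω j => L j s ω).mono
      (le_iSup₂ (f := fun s (_ : s ≤ t) => MeasurableSpace.comap (fun ω j => L j s ω) inferInstance)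
        s hst) le_rfl
  exact (measurable_pi_apply i).comp h1

end Independence

/-! ### The pathwise Ornstein–Uhlenbeck equation -/

section OrnsteinUhlenbeck

/-- The weight with which a unit of noise arriving at time `s` enters
`∫_{(a, b]} Λ(u) Y(u) du` if `Y` decays exponentially at rate `lam`. -/
def noiseWeight (lam : ℝ) (Λ : ℝ → ℝ) (a b s : ℝ) : ℝ :=
  ∫ u in Ioc a b, (Ici s).indicator (fun u => Λ u * Real.exp (-lam * (u - s))) u

variable {lam : ℝ} {Λ σ : ℝ → ℝ} {μ : Measure ℝ} {a b t T C : ℝ}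

/-- Replacing `Λ` by a measurable version leaves the weight unchanged at every `s`, after which the
weight is a parameter integral of a jointly measurable function. -/
lemma measurable_noiseWeight (hΛ : AEStronglyMeasurable Λ (volume.restrict (Ioc a b))) :
    Measurable (noiseWeight lam Λ a b) := by
  have h1 : noiseWeight lam Λ a b = noiseWeight lam (hΛ.mk Λ) a b := by
    ext s
    refine integral_congr_ae ?_
    filter_upwards [hΛ.ae_eq_mk] with u hu
    simp only [indicator, hu]
  rw [h1]
  have hm := hΛ.stronglyMeasurable_mk.measurable
  have h2 : Measurable fun p : ℝ × ℝ =>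
      {p : ℝ × ℝ | p.1 ≤ p.2}.indicator
        (fun p => hΛ.mk Λ p.2 * Real.exp (-lam * (p.2 - p.1))) p :=
    Measurable.indicator (by fun_prop) (measurableSet_le measurable_fst measurable_snd)
  exact (h2.stronglyMeasurable.integral_prod_right (ν := volume.restrict (Ioc a b))).measurable

lemma noiseWeight_nonneg (hΛ : ∀ u ∈ Ioc a b, 0 ≤ Λ u) (s : ℝ) :
    0 ≤ noiseWeight lam Λ a b s :=
  setIntegral_nonneg measurableSet_Ioc fun u hu =>
    indicator_apply_nonneg fun _ => mul_nonneg (hΛ u hu) (Real.exp_pos _).le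

lemma noiseWeight_le (hlam : 0 ≤ lam) (hΛ : ∀ u ∈ Ioc a b, 0 ≤ Λ u)
    (hΛi : IntegrableOn Λ (Ioc a b)) (s : ℝ) :
    noiseWeight lam Λ a b s ≤ ∫ u in Ioc a b, Λ u := by
  refine integral_mono_of_nonneg ?_ hΛi ?_
  · exact ae_restrict_of_forall_mem measurableSet_Ioc fun u hu =>
      indicator_apply_nonneg fun _ => mul_nonneg (hΛ u hu) (Real.exp_pos _).le
  · refine ae_restrict_of_forall_mem measurableSet_Ioc fun u hu => ?_
    refine indicator_apply_le' (fun hs => ?_) (fun _ => hΛ u hu)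
    refine mul_le_of_le_one_right (hΛ u hu) (Real.exp_le_one_iff.2 ?_)
    have : s ≤ u := hs
    nlinarith

/-- On `s ≤ u` the exponential is at most `1`, so `|Λ u| * C` dominates; it is integrable because
`μ` is finite on `(t, b]`. This justifies Fubini below. -/
lemma integrable_noise_prod [IsLocallyFiniteMeasure μ] (hlam : 0 ≤ lam)
    (hΛ : IntegrableOn Λ (Ioc a b)) (hσ : Measurable σ) (hC : ∀ s ∈ Ioc t b, |σ s| ≤ C) :
    Integrable (fun p : ℝ × ℝ => {p : ℝ × ℝ | p.2 ≤ p.1}.indicator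
        (fun p => Λ p.1 * (Real.exp (-lam * (p.1 - p.2)) * σ p.2)) p)
      ((volume.restrict (Ioc a b)).prod (μ.restrict (Ioc t b))) := by
  have hfin : IsFiniteMeasure (μ.restrict (Ioc t b)) := ⟨by simpa using measure_Ioc_lt_top⟩
  have hbound : Integrable (fun p : ℝ × ℝ => ‖Λ p.1‖ * C)
      ((volume.restrict (Ioc a b)).prod (μ.restrict (Ioc t b))) :=
    Integrable.mul_prod hΛ.norm (integrable_const C)
  refine hbound.mono' ?_ ?_
  · refine AEStronglyMeasurable.indicator ?_ (measurableSet_le measurable_snd measurable_fst)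
    exact hΛ.aestronglyMeasurable.comp_fst.mul (by fun_prop)
  · have h2 : ∀ᵐ p ∂((volume.restrict (Ioc a b)).prod (μ.restrict (Ioc t b))),
        p.2 ∈ Ioc t b :=
      Measure.quasiMeasurePreserving_snd.ae (ae_restrict_mem measurableSet_Ioc)
    filter_upwards [h2] with p hp
    have hC0 : 0 ≤ C := (abs_nonneg _).trans (hC _ hp)
    by_cases hle : p.2 ≤ p.1
    · rw [indicator_of_mem (show p ∈ {p : ℝ × ℝ | p.2 ≤ p.1} from hle), norm_mul, norm_mul,
        Real.norm_of_nonneg (Real.exp_pos _).le]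
      refine mul_le_mul_of_nonneg_left ?_ (norm_nonneg _)
      have he : Real.exp (-lam * (p.1 - p.2)) ≤ 1 := Real.exp_le_one_iff.2 (by nlinarith)
      calc Real.exp (-lam * (p.1 - p.2)) * ‖σ p.2‖ ≤ 1 * C :=
            mul_le_mul he (hC _ hp) (norm_nonneg _) zero_le_one
        _ = C := one_mul C
    · rw [indicator_of_notMem (show p ∉ {p : ℝ × ℝ | p.2 ≤ p.1} from hle), norm_zero]
      positivity

lemma setIntegral_noise_section {u : ℝ} (hu : u ∈ Ioc a b) :
    ∫ s in Ioc t b, {p : ℝ × ℝ | p.2 ≤ p.1}.indicator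
        (fun p => Λ p.1 * (Real.exp (-lam * (p.1 - p.2)) * σ p.2)) (u, s) ∂μ
      = Λ u * ∫ s in Ioc t u, Real.exp (-lam * (u - s)) * σ s ∂μ := by
  have h1 : ∀ s, {p : ℝ × ℝ | p.2 ≤ p.1}.indicator
        (fun p => Λ p.1 * (Real.exp (-lam * (p.1 - p.2)) * σ p.2)) (u, s)
      = (Iic u).indicator (fun s => Λ u * (Real.exp (-lam * (u - s)) * σ s)) s := fun s => rfl
  simp only [h1]
  rw [setIntegral_indicator measurableSet_Iic, Ioc_inter_Iic, min_eq_right hu.2,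
    integral_const_mul]

lemma intervalIntegrable_mul_noise [IsLocallyFiniteMeasure μ] (hab : a ≤ b) (hlam : 0 ≤ lam)
    (hΛ : IntegrableOn Λ (Ioc a b)) (hσ : Measurable σ) (hC : ∀ s ∈ Ioc t b, |σ s| ≤ C) :
    IntervalIntegrable (fun u => Λ u * ∫ s in Ioc t u, Real.exp (-lam * (u - s)) * σ s ∂μ)
      volume a b := by
  rw [intervalIntegrable_iff_integrableOn_Ioc_of_le hab]
  refine (integrable_noise_prod (μ := μ) hlam hΛ hσ hC).integral_prod_left.congr ?_
  exact ae_restrict_of_forall_mem measurableSet_Ioc fun u hu => setIntegral_noise_section hu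

lemma integral_mul_noise [IsLocallyFiniteMeasure μ] (hab : a ≤ b) (hlam : 0 ≤ lam)
    (hΛ : IntegrableOn Λ (Ioc a b)) (hσ : Measurable σ) (hC : ∀ s ∈ Ioc t b, |σ s| ≤ C) :
    ∫ u in a..b, Λ u * ∫ s in Ioc t u, Real.exp (-lam * (u - s)) * σ s ∂μ
      = ∫ s in Ioc t b, σ s * noiseWeight lam Λ a b s ∂μ := by
  have hfin : IsFiniteMeasure (μ.restrict (Ioc t b)) := ⟨by simpa using measure_Ioc_lt_top⟩
  rw [intervalIntegral.integral_of_le hab]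
  calc ∫ u in Ioc a b, Λ u * ∫ s in Ioc t u, Real.exp (-lam * (u - s)) * σ s ∂μ
      = ∫ u in Ioc a b, ∫ s in Ioc t b, {p : ℝ × ℝ | p.2 ≤ p.1}.indicator
          (fun p => Λ p.1 * (Real.exp (-lam * (p.1 - p.2)) * σ p.2)) (u, s) ∂μ :=
        setIntegral_congr_fun measurableSet_Ioc fun u hu => (setIntegral_noise_section hu).symm
    _ = ∫ s in Ioc t b, ∫ u in Ioc a b, {p : ℝ × ℝ | p.2 ≤ p.1}.indicator
          (fun p => Λ p.1 * (Real.exp (-lam * (p.1 - p.2)) * σ p.2)) (u, s) ∂volume ∂μ :=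
        integral_integral_swap (integrable_noise_prod hlam hΛ hσ hC)
    _ = ∫ s in Ioc t b, σ s * noiseWeight lam Λ a b s ∂μ := by
        refine setIntegral_congr_fun measurableSet_Ioc fun s _ => ?_
        simp only [noiseWeight]
        rw [← integral_const_mul]
        refine integral_congr_ae (ae_of_all _ fun u => ?_)
        by_cases hsu : s ≤ u
        · simp only [indicator, mem_ofPred_eq, mem_Ici, hsu, if_true]
          ring
        · simp [indicator, hsu]

lemma integral_mul_exp_neg (s t : ℝ) :
    ∫ u in s..t, lam * Real.exp (-lam * (u - s)) = 1 - Real.exp (-lam * (t - s)) := by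
  have hd : ∀ u ∈ uIcc s t, HasDerivAt (fun u => -Real.exp (-lam * (u - s)))
      (lam * Real.exp (-lam * (u - s))) u := by
    intro u _
    have h1 : HasDerivAt (fun u => -lam * (u - s)) (-lam) u := by
      simpa using ((hasDerivAt_id u).sub_const s).const_mul (-lam)
    exact h1.exp.neg.congr_deriv (by ring)
  rw [intervalIntegral.integral_eq_sub_of_hasDerivAt hd
    (Continuous.intervalIntegrable (by fun_prop) _ _)]
  simp
  ring

/-- The constant weight `lam` is the one occurring in the drift, so this checks that the variation
of constants formula solves the equation. -/
lemma noiseWeight_const {s : ℝ} (hs : s ∈ Ioc a b) :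
    noiseWeight lam (fun _ => lam) a b s = 1 - Real.exp (-lam * (b - s)) := by
  rw [noiseWeight, setIntegral_indicator measurableSet_Ici]
  have : Ioc a b ∩ Ici s = Icc s b := by
    ext x
    simp only [mem_inter_iff, mem_Ioc, mem_Ici, mem_Icc]
    exact ⟨fun h => ⟨h.2, h.1.2⟩, fun h => ⟨⟨hs.1.trans_le h.1, h.2⟩, h.1⟩⟩
  rw [this, integral_Icc_eq_integral_Ioc, ← intervalIntegral.integral_of_le hs.2,
    integral_mul_exp_neg]

/-- The equation makes `D` a multiple of its primitive `G`, hence continuous. Then `G` has right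
derivative `D` with `|D| = |lam| |G|` and `G 0 = 0`, and Grönwall's inequality gives `G = 0`. -/
lemma eq_zero_of_eq_neg_mul_integral {D : ℝ → ℝ} (hT : 0 ≤ T)
    (hD : IntervalIntegrable D volume 0 T)
    (h : ∀ t ∈ Icc 0 T, D t = -lam * ∫ s in (0 : ℝ)..t, D s) : ∀ t ∈ Icc 0 T, D t = 0 := by
  set G : ℝ → ℝ := fun t => ∫ s in (0 : ℝ)..t, D s with hG
  have hGc : ContinuousOn G (Icc 0 T) := by
    have := intervalIntegral.continuousOn_primitive_interval' hD left_mem_uIcc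
    rwa [uIcc_of_le hT] at this
  have hDc : ContinuousOn D (Icc 0 T) := (hGc.const_mul (-lam)).congr fun t ht => h t ht
  have hG0 : ∀ t ∈ Icc 0 T, G t = 0 := by
    refine eq_zero_of_abs_deriv_le_mul_abs_self_of_eq_zero_right (f' := D) (K := |lam|) hGc
      (fun x hx => ?_) (by simp [hG]) (fun x hx => ?_)
    · have hmem : Icc 0 T ∈ 𝓝[>] x :=
        mem_of_superset (Ioo_mem_nhdsGT hx.2) fun z hz => ⟨hx.1.trans hz.1.le, hz.2.le⟩
      refine intervalIntegral.integral_hasDerivWithinAt_right (hD.mono_set ?_)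
        (t := Ioi x) ?_ ?_
      · rw [uIcc_of_le hT, uIcc_of_le hx.1]
        exact Icc_subset_Icc_right hx.2.le
      · exact ⟨Icc 0 T, hmem, hDc.aestronglyMeasurable measurableSet_Icc⟩
      · exact (hDc x ⟨hx.1, hx.2.le⟩).mono_of_mem_nhdsWithin hmem
    · rw [h x ⟨hx.1, hx.2.le⟩, norm_mul, norm_neg]
      rfl
  intro t ht
  rw [h t ht]
  have := hG0 t ht
  simp only [hG] at this
  rw [this, mul_zero]

/-- Variation of constants for the pathwise Ornstein–Uhlenbeck equation. -/
lemma ou_explicit [IsLocallyFiniteMeasure μ] {v : ℝ → ℝ} {y : ℝ} (hT : 0 ≤ T) (hlam : 0 ≤ lam)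
    (hσ : Measurable σ) (hC : ∀ s ∈ Ioc 0 T, |σ s| ≤ C) (hv : IntervalIntegrable v volume 0 T)
    (h : ∀ t ∈ Icc 0 T, v t = y - (∫ s in (0 : ℝ)..t, lam * v s) + ∫ s in Ioc 0 t, σ s ∂μ) :
    ∀ t ∈ Icc 0 T,
      v t = Real.exp (-lam * t) * y + ∫ s in Ioc 0 t, Real.exp (-lam * (t - s)) * σ s ∂μ := by
  set w : ℝ → ℝ := fun t =>
    Real.exp (-lam * t) * y + ∫ s in Ioc 0 t, Real.exp (-lam * (t - s)) * σ s ∂μ with hw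
  have hσi : ∀ t ≤ T, IntegrableOn σ (Ioc 0 t) μ := fun t ht =>
    have : IsFiniteMeasure (μ.restrict (Ioc 0 t)) := ⟨by simpa using measure_Ioc_lt_top⟩
    Integrable.of_bound hσ.aestronglyMeasurable C
      (ae_restrict_of_forall_mem measurableSet_Ioc fun s hs => hC s ⟨hs.1, hs.2.trans ht⟩)
  have hσe : ∀ t ≤ T, IntegrableOn (fun s => Real.exp (-lam * (t - s)) * σ s) (Ioc 0 t) μ := by
    intro t ht
    refine (hσi t ht).norm.mono' (by fun_prop)
      (ae_restrict_of_forall_mem measurableSet_Ioc fun s hs => ?_)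
    rw [norm_mul, Real.norm_of_nonneg (Real.exp_pos _).le]
    refine mul_le_of_le_one_left (norm_nonneg _) (Real.exp_le_one_iff.2 ?_)
    nlinarith [hs.2]
  have hwi : ∀ t ∈ Icc 0 T, IntervalIntegrable (fun s => lam * w s) volume 0 t := by
    intro t ht
    have := intervalIntegrable_mul_noise (μ := μ) (t := 0) (Λ := fun _ => lam) ht.1 hlam
      (integrableOn_const (by simp)) hσ (fun s hs => hC s ⟨hs.1, hs.2.trans ht.2⟩)
    refine (IntervalIntegrable.add (Continuous.intervalIntegrable
      (u := fun s => lam * (Real.exp (-lam * s) * y)) (by fun_prop) 0 t) this).congr ?_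
    exact fun s _ => by simp only [hw]; ring
  -- The candidate `w` solves the same equation: Fubini turns the drift of its noise part into `∫
  -- σ(s) (1 - exp(-lam (t - s))) dμ`. The difference `v - w` then solves the homogeneous equation.
  have hweq : ∀ t ∈ Icc 0 T, w t = y - (∫ s in (0 : ℝ)..t, lam * w s) + ∫ s in Ioc 0 t, σ s ∂μ := by
    intro t ht
    have hC' : ∀ s ∈ Ioc 0 t, |σ s| ≤ C := fun s hs => hC s ⟨hs.1, hs.2.trans ht.2⟩
    have h1 := intervalIntegrable_mul_noise (μ := μ) (t := 0) (Λ := fun _ => lam) ht.1 hlam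
      (integrableOn_const (by simp)) hσ hC'
    have h2 := integral_mul_noise (μ := μ) (t := 0) (Λ := fun _ => lam) ht.1 hlam
      (integrableOn_const (by simp)) hσ hC'
    have h3 : ∫ s in (0 : ℝ)..t, lam * (Real.exp (-lam * s) * y) = (1 - Real.exp (-lam * t)) * y := by
      have := integral_mul_exp_neg (lam := lam) 0 t
      simp only [sub_zero] at this
      rw [← this, ← intervalIntegral.integral_mul_const]
      simp only [mul_assoc]
    have h4 : ∫ s in (0 : ℝ)..t, lam * w s = (1 - Real.exp (-lam * t)) * y
        + ∫ s in Ioc 0 t, σ s * noiseWeight lam (fun _ => lam) 0 t s ∂μ := by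
      rw [← h2, ← h3, ← intervalIntegral.integral_add
        (Continuous.intervalIntegrable (by fun_prop) 0 t) h1]
      simp only [hw, mul_add]
    have h5 : ∫ s in Ioc 0 t, σ s * noiseWeight lam (fun _ => lam) 0 t s ∂μ
        = (∫ s in Ioc 0 t, σ s ∂μ) - ∫ s in Ioc 0 t, Real.exp (-lam * (t - s)) * σ s ∂μ := by
      rw [← integral_sub (hσi t ht.2) (hσe t ht.2)]
      refine setIntegral_congr_fun measurableSet_Ioc fun s hs => ?_
      simp only [noiseWeight_const hs]
      ring
    rw [h4, h5]
    simp only [hw]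
    ring
  have hvi : ∀ t ∈ Icc 0 T, IntervalIntegrable (fun s => lam * v s) volume 0 t := by
    intro t ht
    refine (hv.mono_set ?_).const_mul lam
    rw [uIcc_of_le hT, uIcc_of_le ht.1]
    exact Icc_subset_Icc_right ht.2
  intro t ht
  -- Integrability of `w` is obtained by dividing that of `lam * w` by `lam`; for `lam = 0` the
  -- drift disappears and the two equations agree directly.
  rcases hlam.eq_or_lt with hl | hl
  · have h1 := h t ht
    have h2 := hweq t ht
    simp only [← hl, zero_mul, intervalIntegral.integral_zero] at h1 h2
    exact h1.trans h2.symm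
  have hwi' : IntervalIntegrable w volume 0 T := by
    have := (hwi T (right_mem_Icc.2 hT)).const_mul lam⁻¹
    simpa only [inv_mul_cancel_left₀ hl.ne'] using this
  have hD : ∀ t ∈ Icc 0 T, (fun s => v s - w s) t
      = -lam * ∫ s in (0 : ℝ)..t, (fun s => v s - w s) s := by
    intro t ht
    simp only
    rw [h t ht, hweq t ht, ← intervalIntegral.integral_const_mul]
    have : ∀ s, -lam * (v s - w s) = lam * w s - lam * v s := fun s => by ring
    simp only [this]
    rw [intervalIntegral.integral_sub (hwi t ht) (hvi t ht)]
    ring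
  have := eq_zero_of_eq_neg_mul_integral hT (hv.sub hwi') hD t ht
  exact sub_eq_zero.1 this

/-- Splitting the noise integral at `t` and factoring `exp(-lam (u - t))` out of the part before `t`
leaves exactly `v t`. -/
lemma ou_restart [IsLocallyFiniteMeasure μ] {v : ℝ → ℝ} {y : ℝ} (hlam : 0 ≤ lam)
    (hσ : Measurable σ) (hC : ∀ s ∈ Ioc 0 T, |σ s| ≤ C)
    (h : ∀ t ∈ Icc 0 T,
      v t = Real.exp (-lam * t) * y + ∫ s in Ioc 0 t, Real.exp (-lam * (t - s)) * σ s ∂μ)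
    {u : ℝ} (ht : 0 ≤ t) (htu : t ≤ u) (huT : u ≤ T) :
    v u = Real.exp (-lam * (u - t)) * v t
      + ∫ s in Ioc t u, Real.exp (-lam * (u - s)) * σ s ∂μ := by
  have hi : IntegrableOn (fun s => Real.exp (-lam * (u - s)) * σ s) (Ioc 0 u) μ := by
    have : IsFiniteMeasure (μ.restrict (Ioc 0 u)) := ⟨by simpa using measure_Ioc_lt_top⟩
    refine Integrable.of_bound (by fun_prop) C
      (ae_restrict_of_forall_mem measurableSet_Ioc fun s hs => ?_)
    rw [norm_mul, Real.norm_of_nonneg (Real.exp_pos _).le]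
    refine (mul_le_of_le_one_left (norm_nonneg _) (Real.exp_le_one_iff.2 ?_)).trans
      (hC s ⟨hs.1, hs.2.trans huT⟩)
    nlinarith [hs.2]
  have he : ∀ r, Real.exp (-lam * (u - t)) * Real.exp (-lam * (t - r))
      = Real.exp (-lam * (u - r)) := fun r => by rw [← Real.exp_add]; ring_nf
  have h1 : Real.exp (-lam * (u - t)) * ∫ s in Ioc 0 t, Real.exp (-lam * (t - s)) * σ s ∂μ
      = ∫ s in Ioc 0 t, Real.exp (-lam * (u - s)) * σ s ∂μ := by
    simp only [← integral_const_mul, ← mul_assoc, he]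
  have h2 := he 0
  simp only [sub_zero] at h2
  have h3 := setIntegral_union (μ := μ) (Ioc_disjoint_Ioc_of_le le_rfl) measurableSet_Ioc
    (hi.mono_set (Ioc_subset_Ioc_right htu)) (hi.mono_set (Ioc_subset_Ioc_left ht))
  rw [Ioc_union_Ioc_eq_Ioc ht htu] at h3
  rw [h u ⟨ht.trans htu, huT⟩, h t ⟨ht, htu.trans huT⟩, h3, mul_add, h1, ← mul_assoc, h2,
    add_assoc]

lemma intervalIntegrable_mul_ou_and_integral [IsLocallyFiniteMeasure μ] {v : ℝ → ℝ} {y : ℝ}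
    (hlam : 0 ≤ lam) (hσ : Measurable σ) (hC : ∀ s ∈ Ioc 0 T, |σ s| ≤ C)
    (h : ∀ t ∈ Icc 0 T,
      v t = Real.exp (-lam * t) * y + ∫ s in Ioc 0 t, Real.exp (-lam * (t - s)) * σ s ∂μ)
    (ht : 0 ≤ t) (hta : t ≤ a) (hab : a ≤ b) (hbT : b ≤ T) (hΛ : IntegrableOn Λ (Ioc a b)) :
    IntervalIntegrable (fun u => Λ u * v u) volume a b ∧
    ∫ u in a..b, Λ u * v u = v t * (∫ u in a..b, Λ u * Real.exp (-lam * (u - t)))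
      + ∫ s in Ioc t b, σ s * noiseWeight lam Λ a b s ∂μ := by
  have hC' : ∀ s ∈ Ioc t b, |σ s| ≤ C := fun s hs => hC s ⟨ht.trans_lt hs.1, hs.2.trans hbT⟩
  have h1 : IntervalIntegrable (fun u => v t * (Λ u * Real.exp (-lam * (u - t)))) volume a b := by
    have hΛ' := (intervalIntegrable_iff_integrableOn_Ioc_of_le hab).2 hΛ
    exact (hΛ'.mul_continuousOn (by fun_prop)).const_mul _
  have h2 := intervalIntegrable_mul_noise (μ := μ) hab hlam hΛ hσ hC'
  have heq : EqOn (fun u => v t * (Λ u * Real.exp (-lam * (u - t)))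
      + Λ u * ∫ s in Ioc t u, Real.exp (-lam * (u - s)) * σ s ∂μ)
      (fun u => Λ u * v u) (uIcc a b) := by
    intro u hu
    rw [uIcc_of_le hab] at hu
    simp only
    rw [ou_restart hlam hσ hC h ht (hta.trans hu.1) (hu.2.trans hbT)]
    ring
  refine ⟨(h1.add h2).congr fun u hu => heq (uIoc_subset_uIcc hu), ?_⟩
  rw [← intervalIntegral.integral_congr heq, intervalIntegral.integral_add h1 h2,
    intervalIntegral.integral_const_mul, integral_mul_noise hab hlam hΛ hσ hC']

end OrnsteinUhlenbeck

/-! ### Spot price integrals and their conditional expectations -/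

section SpotPrice

variable {Ω : Type*} {mΩ : MeasurableSpace Ω} {P : Measure Ω}

/-- One term of the spot price model: a Lévy-driven Ornstein–Uhlenbeck process `Y` on `[0, T]`
together with a nonnegative weight `Λ` which is integrable on the delivery period `(T₁, T₂]`. -/
structure IsWeightedOU (P : Measure Ω) (T T₁ T₂ : ℝ≥0) (Λ σ : ℝ → ℝ) (lam y : ℝ) (ν : Measure ℝ)
    (L Y : ℝ≥0 → Ω → ℝ) : Prop where
  lam_nonneg : 0 ≤ lam
  sigma_meas : Measurable σ
  sigma_nonneg : ∀ s ∈ Icc (0 : ℝ) T, 0 ≤ σ s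
  sigma_bdd : ∃ C : ℝ, ∀ s ∈ Icc (0 : ℝ) T, σ s ≤ C
  levy : IsIncreasingPureJumpLevy L ν P
  int_nu : IntegrableOn (fun z : ℝ => z) (Ioi 0) ν
  sol : IsOUSolution T lam y σ L Y P
  le_horizon : T₂ ≤ T
  weight_nonneg : ∀ u ∈ Ioc (T₁ : ℝ) T₂, 0 ≤ Λ u
  weight_int : IntegrableOn Λ (Ioc (T₁ : ℝ) T₂)

/-- The contribution of the noise on `(t, b]` to `∫_{(a, b]} Λ(u) Y(u) du`. -/
def noiseContribution (Λ σ : ℝ → ℝ) (lam : ℝ) (L : ℝ≥0 → Ω → ℝ) (t a b : ℝ≥0) (ω : Ω) : ℝ :=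
  ∫ s in Ioc (t : ℝ) b, σ s * noiseWeight lam Λ a b s ∂(pathStieltjes fun r => L r ω)

namespace IsWeightedOU

variable {T T₁ T₂ : ℝ≥0} {Λ σ : ℝ → ℝ} {lam y : ℝ} {ν : Measure ℝ} {L Y : ℝ≥0 → Ω → ℝ}

lemma abs_sigma_le (h : IsWeightedOU P T T₁ T₂ Λ σ lam y ν L Y) :
    ∃ C : ℝ, 0 ≤ C ∧ ∀ s ∈ Ioc (0 : ℝ) T, |σ s| ≤ C := by
  obtain ⟨C, hC⟩ := h.sigma_bdd
  refine ⟨C, (h.sigma_nonneg 0 ⟨le_rfl, T.2⟩).trans (hC 0 ⟨le_rfl, T.2⟩), fun s hs => ?_⟩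
  rw [abs_of_nonneg (h.sigma_nonneg s (Ioc_subset_Icc_self hs))]
  exact hC s (Ioc_subset_Icc_self hs)

lemma weight_int_mono (h : IsWeightedOU P T T₁ T₂ Λ σ lam y ν L Y) {a b : ℝ≥0} (ha : T₁ ≤ a)
    (hb : b ≤ T₂) : IntegrableOn Λ (Ioc (a : ℝ) b) :=
  h.weight_int.mono_set (Ioc_subset_Ioc (by exact_mod_cast ha) (by exact_mod_cast hb))

lemma weight_nonneg_mono (h : IsWeightedOU P T T₁ T₂ Λ σ lam y ν L Y) {a b : ℝ≥0} (ha : T₁ ≤ a)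
    (hb : b ≤ T₂) : ∀ u ∈ Ioc (a : ℝ) b, 0 ≤ Λ u := fun u hu =>
  h.weight_nonneg u ⟨lt_of_le_of_lt (by exact_mod_cast ha) hu.1,
    hu.2.trans (by exact_mod_cast hb)⟩

lemma explicit (h : IsWeightedOU P T T₁ T₂ Λ σ lam y ν L Y) :
    ∀ᵐ ω ∂P, ∀ t ∈ Icc (0 : ℝ) T, Y t.toNNReal ω = Real.exp (-lam * t) * y
      + ∫ s in Ioc 0 t, Real.exp (-lam * (t - s)) * σ s ∂(pathStieltjes fun r => L r ω) := by
  obtain ⟨C, _, hC⟩ := h.abs_sigma_le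
  filter_upwards [h.sol] with ω hω
  refine ou_explicit (v := fun t => Y t.toNNReal ω) T.2 h.lam_nonneg h.sigma_meas hC hω.1
    fun t ht => ?_
  have := hω.2 t.toNNReal (Real.toNNReal_le_iff_le_coe.2 ht.2)
  rwa [Real.coe_toNNReal _ ht.1] at this

lemma integral_ae (h : IsWeightedOU P T T₁ T₂ Λ σ lam y ν L Y) {t a b : ℝ≥0} (hta : t ≤ a)
    (hab : a ≤ b) (ha : T₁ ≤ a) (hb : b ≤ T₂) :
    ∀ᵐ ω ∂P, IntervalIntegrable (fun u : ℝ => Λ u * Y u.toNNReal ω) volume a b ∧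
      ∫ u in (a : ℝ)..b, Λ u * Y u.toNNReal ω
        = Y t ω * (∫ u in (a : ℝ)..b, Λ u * Real.exp (-lam * (u - t)))
          + noiseContribution Λ σ lam L t a b ω := by
  obtain ⟨C, _, hC⟩ := h.abs_sigma_le
  filter_upwards [h.explicit] with ω hω
  have := intervalIntegrable_mul_ou_and_integral h.lam_nonneg h.sigma_meas hC hω t.2
    (NNReal.coe_le_coe.2 hta) (NNReal.coe_le_coe.2 hab)
    (NNReal.coe_le_coe.2 (hb.trans h.le_horizon)) (h.weight_int_mono ha hb)
  simp only [NNReal.val_eq_coe, Real.toNNReal_coe] at this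
  exact this

lemma measurable_noise (h : IsWeightedOU P T T₁ T₂ Λ σ lam y ν L Y) {a b : ℝ≥0}
    (ha : T₁ ≤ a) (hb : b ≤ T₂) : Measurable fun s => σ s * noiseWeight lam Λ a b s :=
  h.sigma_meas.mul (measurable_noiseWeight (h.weight_int_mono ha hb).aestronglyMeasurable)

lemma noise_nonneg (h : IsWeightedOU P T T₁ T₂ Λ σ lam y ν L Y) {t a b : ℝ≥0}
    (ha : T₁ ≤ a) (hb : b ≤ T₂) :
    ∀ s ∈ Ioc (t : ℝ) b, 0 ≤ σ s * noiseWeight lam Λ a b s := fun s hs =>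
  mul_nonneg (h.sigma_nonneg s ⟨t.2.trans hs.1.le,
      hs.2.trans (NNReal.coe_le_coe.2 (hb.trans h.le_horizon))⟩)
    (noiseWeight_nonneg (h.weight_nonneg_mono ha hb) s)

lemma stronglyMeasurable_noiseContribution (h : IsWeightedOU P T T₁ T₂ Λ σ lam y ν L Y)
    {m : MeasurableSpace Ω} {t a b : ℝ≥0} (ha : T₁ ≤ a) (hb : b ≤ T₂)
    (hm : ∀ c d : ℝ≥0, t ≤ c → c ≤ d → d ≤ b → Measurable[m] fun ω => L d ω - L c ω) :
    StronglyMeasurable[m] (noiseContribution Λ σ lam L t a b) :=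
  stronglyMeasurable_integral_pathStieltjes h.levy.monotone_paths h.levy.right_continuous hm
    (h.measurable_noise ha hb) (h.noise_nonneg ha hb)

lemma integrable_noiseContribution_and_integral [IsProbabilityMeasure P]
    (h : IsWeightedOU P T T₁ T₂ Λ σ lam y ν L Y)
    {t a b : ℝ≥0} (ha : T₁ ≤ a) (hb : b ≤ T₂) :
    Integrable (noiseContribution Λ σ lam L t a b) P ∧
    ∫ ω, noiseContribution Λ σ lam L t a b ω ∂P
      = (∫ z in Ioi 0, z ∂ν) * ∫ s in Ioc (t : ℝ) b, σ s * noiseWeight lam Λ a b s := by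
  obtain ⟨C, hC0, hC⟩ := h.abs_sigma_le
  refine h.levy.integrable_and_integral h.int_nu t b (h.measurable_noise ha hb)
    (h.noise_nonneg ha hb) (C := C * ∫ u in Ioc (a : ℝ) b, Λ u) fun s hs => ?_
  refine mul_le_mul ((le_abs_self _).trans (hC s ⟨lt_of_le_of_lt t.2 hs.1,
    hs.2.trans (NNReal.coe_le_coe.2 (hb.trans h.le_horizon))⟩)) ?_
    (noiseWeight_nonneg (h.weight_nonneg_mono ha hb) s) hC0
  exact noiseWeight_le h.lam_nonneg (h.weight_nonneg_mono ha hb) (h.weight_int_mono ha hb) s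

/-- The mean replaces `dL` by `(∫ z ν(dz)) ds`; the Fubini identity `integral_mul_noise`, now for
Lebesgue measure and read backwards, restores the iterated integral. -/
lemma integral_noiseContribution [IsProbabilityMeasure P]
    (h : IsWeightedOU P T T₁ T₂ Λ σ lam y ν L Y)
    {t a b : ℝ≥0} (hta : t ≤ a) (hab : a ≤ b) (ha : T₁ ≤ a) (hb : b ≤ T₂) :
    ∫ ω, noiseContribution Λ σ lam L t a b ω ∂P
      = ∫ u in (a : ℝ)..b, ∫ s in (t : ℝ)..u, ∫ z in Ioi (0 : ℝ),
          σ s * Λ u * Real.exp (-lam * (u - s)) * z ∂ν := by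
  obtain ⟨C, hC0, hC⟩ := h.abs_sigma_le
  have hab' : (a : ℝ) ≤ b := NNReal.coe_le_coe.2 hab
  rw [(h.integrable_noiseContribution_and_integral ha hb).2,
    ← integral_mul_noise (μ := volume) (t := (t : ℝ)) hab' h.lam_nonneg
      (h.weight_int_mono ha hb) h.sigma_meas
      (fun s hs => hC s ⟨lt_of_le_of_lt t.2 hs.1,
        hs.2.trans (NNReal.coe_le_coe.2 (hb.trans h.le_horizon))⟩),
    ← intervalIntegral.integral_const_mul]
  refine intervalIntegral.integral_congr fun u hu => ?_
  rw [uIcc_of_le hab'] at hu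
  rw [intervalIntegral.integral_of_le ((NNReal.coe_le_coe.2 hta).trans hu.1), ← mul_assoc,
    ← integral_const_mul]
  refine integral_congr_ae (ae_of_all _ fun s => ?_)
  simp only
  rw [integral_const_mul]
  ring

/-- The explicit solution involves only increments up to `t`. It equals `Y t` only almost surely,
hence measurability up to a null set. -/
lemma aestronglyMeasurable_and_integrable [IsProbabilityMeasure P]
    (h : IsWeightedOU P T T₁ T₂ Λ σ lam y ν L Y)
    {m : MeasurableSpace Ω} {t : ℝ≥0} (ht : t ≤ T) (hm : ∀ s ≤ t, Measurable[m] (L s)) :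
    AEStronglyMeasurable[m] (Y t) P ∧ Integrable (Y t) P := by
  obtain ⟨C, hC0, hC⟩ := h.abs_sigma_le
  let g : ℝ → ℝ := fun s => Real.exp (-lam * (t - s)) * σ s
  have hg : Measurable g := by have := h.sigma_meas; fun_prop
  have hpos : ∀ s ∈ Ioc ((0 : ℝ≥0) : ℝ) t, 0 ≤ g s := fun s hs =>
    mul_nonneg (Real.exp_pos _).le (h.sigma_nonneg s ⟨hs.1.le, hs.2.trans (by exact_mod_cast ht)⟩)
  have heq : Y t =ᵐ[P] fun ω => Real.exp (-lam * t) * y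
      + ∫ s in Ioc ((0 : ℝ≥0) : ℝ) t, g s ∂(pathStieltjes fun r => L r ω) := by
    filter_upwards [h.explicit] with ω hω
    have := hω t ⟨t.2, by exact_mod_cast ht⟩
    rwa [Real.toNNReal_coe] at this
  have hsm : StronglyMeasurable[m] fun ω => Real.exp (-lam * t) * y
      + ∫ s in Ioc ((0 : ℝ≥0) : ℝ) t, g s ∂(pathStieltjes fun r => L r ω) :=
    stronglyMeasurable_const.add (stronglyMeasurable_integral_pathStieltjes h.levy.monotone_paths
      h.levy.right_continuous (fun c d _ hcd hd => (hm d hd).sub (hm c (hcd.trans hd))) hg hpos)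
  refine ⟨⟨_, hsm, heq⟩, Integrable.congr ?_ heq.symm⟩
  refine (integrable_const _).add
    (h.levy.integrable_and_integral h.int_nu 0 t hg hpos (C := C) fun s hs => ?_).1
  refine (mul_le_of_le_one_left (h.sigma_nonneg s ⟨hs.1.le, hs.2.trans (by exact_mod_cast ht)⟩)
    (Real.exp_le_one_iff.2 ?_)).trans
    ((le_abs_self _).trans (hC s ⟨hs.1, hs.2.trans (by exact_mod_cast ht)⟩))
  nlinarith [hs.2, h.lam_nonneg]

end IsWeightedOU

lemma aestronglyMeasurable_sum_of_forall {ι : Type*} [Fintype ι] {m : MeasurableSpace Ω}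
    {f : ι → Ω → ℝ} (hf : ∀ i, AEStronglyMeasurable[m] (f i) P) :
    AEStronglyMeasurable[m] (fun ω => ∑ i, f i ω) P := by
  choose g hg hfg using hf
  refine ⟨fun ω => ∑ i, g i ω, Finset.stronglyMeasurable_fun_sum _ fun i _ => hg i, ?_⟩
  filter_upwards [ae_all_iff.2 hfg] with ω hω
  exact Finset.sum_congr rfl fun i _ => hω i

/-- Each `R i` is only required to be independent of `m` separately, since linearity reduces the
claim to one term at a time. -/
lemma condExp_add_sum_of_indep [IsProbabilityMeasure P] {ι : Type*} [Fintype ι]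
    {m : MeasurableSpace Ω} (hm : m ≤ mΩ)
    {X A : Ω → ℝ} {R : ι → Ω → ℝ} (hX : X =ᵐ[P] fun ω => A ω + ∑ i, R i ω)
    (hA : AEStronglyMeasurable[m] A P) (hAi : Integrable A P) {m' : ι → MeasurableSpace Ω}
    (hm' : ∀ i, m' i ≤ mΩ) (hR : ∀ i, StronglyMeasurable[m' i] (R i))
    (hRi : ∀ i, Integrable (R i) P) (hind : ∀ i, Indep (m' i) m P) :
    P[X | m] =ᵐ[P] fun ω => A ω + ∑ i, ∫ ω', R i ω' ∂P := by
  have h1 : X =ᵐ[P] A + ∑ i, R i := by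
    filter_upwards [hX] with ω hω
    simp [hω]
  have h2 : ∀ i, P[R i | m] =ᵐ[P] fun _ => ∫ ω, R i ω ∂P := fun i =>
    condExp_indep_eq (hm' i) hm (hR i) (hind i)
  have hsum : Integrable (∑ i, R i) P := integrable_finsetSum' _ fun i _ => hRi i
  filter_upwards [condExp_congr_ae (m := m) h1, condExp_add hAi hsum m,
    condExp_of_aestronglyMeasurable' hm hA hAi,
    condExp_finsetSum (s := Finset.univ) (f := R) (fun i _ => hRi i) m, ae_all_iff.2 h2]
    with ω e1 e2 e3 e4 e5
  rw [e1, e2, Pi.add_apply, e3, e4, Finset.sum_apply]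
  simp only [e5]

section Model

variable {n : ℕ} {T T₁ T₂ : ℝ≥0} {Λ σ : Fin n → ℝ → ℝ} {lam y : Fin n → ℝ}
  {ν : Fin n → Measure ℝ} {L Y : Fin n → ℝ≥0 → Ω → ℝ}

lemma spotPrice_integral_ae
    (h : ∀ i, IsWeightedOU P T T₁ T₂ (Λ i) (σ i) (lam i) (y i) (ν i) (L i) (Y i)) {t a b : ℝ≥0}
    (hta : t ≤ a) (hab : a ≤ b) (ha : T₁ ≤ a) (hb : b ≤ T₂) :
    ∀ᵐ ω ∂P, IntervalIntegrable (fun u : ℝ => spotPrice Λ Y u.toNNReal ω) volume a b ∧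
      ∫ u in (a : ℝ)..b, spotPrice Λ Y u.toNNReal ω
        = (∑ i, Y i t ω * ∫ u in (a : ℝ)..b, Λ i u * Real.exp (-lam i * (u - t)))
          + ∑ i, noiseContribution (Λ i) (σ i) (lam i) (L i) t a b ω := by
  filter_upwards [ae_all_iff.2 fun i => (h i).integral_ae hta hab ha hb] with ω hω
  have heq : EqOn (fun u : ℝ => ∑ i, Λ i u * Y i u.toNNReal ω)
      (fun u : ℝ => spotPrice Λ Y u.toNNReal ω) (uIcc a b) := by
    intro u hu
    rw [uIcc_of_le (NNReal.coe_le_coe.2 hab)] at hu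
    simp only [spotPrice, Real.coe_toNNReal u (a.2.trans hu.1)]
  refine ⟨IntervalIntegrable.congr (fun u hu => heq (uIoc_subset_uIcc hu)) ?_, ?_⟩
  · have := IntervalIntegrable.sum (μ := volume) Finset.univ
      (f := fun i (u : ℝ) => Λ i u * Y i u.toNNReal ω) fun i _ => (hω i).1
    simpa only [Finset.sum_fn] using this
  · rw [← intervalIntegral.integral_congr heq,
      intervalIntegral.integral_finsetSum fun i _ => (hω i).1, ← Finset.sum_add_distrib]
    exact Finset.sum_congr rfl fun i _ => (hω i).2

lemma integrable_integral_spotPrice [IsProbabilityMeasure P]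
    (h : ∀ i, IsWeightedOU P T T₁ T₂ (Λ i) (σ i) (lam i) (y i) (ν i) (L i) (Y i)) {a b : ℝ≥0}
    (hab : a ≤ b) (ha : T₁ ≤ a) (hb : b ≤ T₂) :
    Integrable (fun ω => ∫ u in (a : ℝ)..b, spotPrice Λ Y u.toNNReal ω) P := by
  refine Integrable.congr (f := fun ω =>
    (∑ i, Y i 0 ω * ∫ u in (a : ℝ)..b, Λ i u * Real.exp (-lam i * (u - (0 : ℝ≥0))))
      + ∑ i, noiseContribution (Λ i) (σ i) (lam i) (L i) 0 a b ω) ?_ ?_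
  · refine (integrable_finsetSum _ fun i _ => ?_).add (integrable_finsetSum _ fun i _ =>
      ((h i).integrable_noiseContribution_and_integral ha hb).1)
    exact ((h i).aestronglyMeasurable_and_integrable (m := mΩ) (t := 0) zero_le
      fun s _ => (h i).levy.measurable s).2.mul_const _
  · filter_upwards [spotPrice_integral_ae h (t := 0) zero_le hab ha hb] with ω hω
    exact hω.2.symm

/-- Decomposing from time `0` expresses the integral through initial values and noise on `(0, b]`,
which avoids any joint measurability of `Y`. -/
lemma aestronglyMeasurable_integral_spotPrice [IsProbabilityMeasure P]
    (h : ∀ i, IsWeightedOU P T T₁ T₂ (Λ i) (σ i) (lam i) (y i) (ν i) (L i) (Y i)) {a b : ℝ≥0}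
    (hab : a ≤ b) (ha : T₁ ≤ a) (hb : b ≤ T₂) :
    AEStronglyMeasurable[generatedFiltration L (fun i => (h i).levy.measurable) b]
      (fun ω => ∫ u in (a : ℝ)..b, spotPrice Λ Y u.toNNReal ω) P := by
  have hLm : ∀ i, ∀ s ≤ b,
      Measurable[generatedFiltration L (fun i => (h i).levy.measurable) b] (L i s) :=
    fun i s hs => measurable_generatedFiltration _ i hs
  refine AEStronglyMeasurable.congr (f := fun ω =>
    (∑ i, Y i 0 ω * ∫ u in (a : ℝ)..b, Λ i u * Real.exp (-lam i * (u - (0 : ℝ≥0))))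
      + ∑ i, noiseContribution (Λ i) (σ i) (lam i) (L i) 0 a b ω) ?_ ?_
  · refine (aestronglyMeasurable_sum_of_forall fun i => ?_).add
      (aestronglyMeasurable_sum_of_forall fun i =>
        ((h i).stronglyMeasurable_noiseContribution ha hb fun c d _ hcd hd =>
          (hLm i d hd).sub (hLm i c (hcd.trans hd))).aestronglyMeasurable)
    exact ((h i).aestronglyMeasurable_and_integrable (t := 0) zero_le
      fun s hs => hLm i s (hs.trans zero_le)).1.mul_const _
  · filter_upwards [spotPrice_integral_ae h (t := 0) zero_le hab ha hb] with ω hω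
    exact hω.2.symm

lemma condExp_integral_spotPrice [IsProbabilityMeasure P]
    (h : ∀ i, IsWeightedOU P T T₁ T₂ (Λ i) (σ i) (lam i) (y i) (ν i) (L i) (Y i))
    (hind : iIndepFun (fun i ω t => L i t ω) P) {t a b : ℝ≥0}
    (hta : t ≤ a) (hab : a ≤ b) (ha : T₁ ≤ a) (hb : b ≤ T₂) :
    P[fun ω => ∫ u in (a : ℝ)..b, spotPrice Λ Y u.toNNReal ω |
        generatedFiltration L (fun i => (h i).levy.measurable) t]
      =ᵐ[P] fun ω =>
        (∑ i, Y i t ω * ∫ u in (a : ℝ)..b, Λ i u * Real.exp (-lam i * (u - t)))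
          + ∑ i, ∫ u in (a : ℝ)..b, ∫ s in (t : ℝ)..u, ∫ z in Ioi (0 : ℝ),
              σ i s * Λ i u * Real.exp (-lam i * (u - s)) * z ∂(ν i) := by
  -- The bound `T₂ ≤ T` is part of `h i`, so it is available only in the presence of an index; `n =
  -- 0` is allowed.
  have htT : ∀ i : Fin n, t ≤ T := fun i => (hta.trans hab).trans (hb.trans (h i).le_horizon)
  have hY := fun i => (h i).aestronglyMeasurable_and_integrable (htT i)
    (m := generatedFiltration L (fun i => (h i).levy.measurable) t)
    fun s hs => measurable_generatedFiltration _ i hs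
  simp only [← fun i => (h i).integral_noiseContribution hta hab ha hb]
  refine condExp_add_sum_of_indep (Filtration.le _ t)
    ((spotPrice_integral_ae h hta hab ha hb).mono fun ω hω => hω.2)
    (aestronglyMeasurable_sum_of_forall fun i => (hY i).1.mul_const _)
    (integrable_finsetSum _ fun i _ => (hY i).2.mul_const _)
    (m' := fun i => MeasurableSpace.comap (fun ω (s : Ici t) => L i s ω - L i t ω) inferInstance)
    (fun i => comap_pi_le fun s => ((h i).levy.measurable s).sub ((h i).levy.measurable t))
    (fun i => (h i).stronglyMeasurable_noiseContribution ha hb fun c d hc hcd _ => ?_)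
    (fun i => ((h i).integrable_noiseContribution_and_integral ha hb).1)
    (fun i => indep_increments_generatedFiltration _ (fun i => (h i).levy.start_zero)
      (fun i => (h i).levy.indep_increments) hind i t)
  have hinc : ∀ s : Ici t, Measurable[MeasurableSpace.comap
      (fun ω (s : Ici t) => L i s ω - L i t ω) inferInstance] fun ω => L i s ω - L i t ω :=
    fun s => (measurable_pi_apply s).comp
      (comap_measurable fun ω (s : Ici t) => L i s ω - L i t ω)
  have := (hinc ⟨d, hc.trans hcd⟩).sub (hinc ⟨c, hc⟩)
  -- An increment over `(c, d]` with `t ≤ c` is a difference of two increments started at `t`.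
  have heq : (fun ω => L i d ω - L i c ω)
      = (fun ω => L i d ω - L i t ω) - fun ω => L i c ω - L i t ω := by
    ext ω
    simp
  rw [heq]
  exact this

end Model
end SpotPrice

end

/-! ### The futures price before and during delivery -/

theorem proposition4p3 {Ω : Type*} {mΩ : MeasurableSpace Ω} (P : Measure Ω)
    [IsProbabilityMeasure P] (n : ℕ) (T : ℝ≥0)
    (Λ σ : Fin n → ℝ → ℝ) (lam y : Fin n → ℝ) (ν : Fin n → Measure ℝ)
    (L Y : Fin n → ℝ≥0 → Ω → ℝ)
    (hΛ_pos : ∀ i, ∀ t ∈ Icc (0 : ℝ) T, 0 < Λ i t)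
    (hlam : ∀ i, 0 < lam i)
    (hσ_meas : ∀ i, Measurable (σ i))
    (hσ_pos : ∀ i, ∀ t ∈ Icc (0 : ℝ) T, 0 < σ i t)
    (hσ_bdd : ∀ i, ∃ C : ℝ, ∀ t ∈ Icc (0 : ℝ) T, σ i t ≤ C)
    (hL : ∀ i, IsIncreasingPureJumpLevy (L i) (ν i) P)
    (hL_indep : iIndepFun (fun i ω t => L i t ω) P)
    (hν : ∀ i, IntegrableOn (fun z : ℝ => z) (Ioi 0) (ν i))
    (hY : ∀ i, IsOUSolution T (lam i) (y i) (σ i) (L i) (Y i) P)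
    (T₁ T₂ : ℝ≥0) (hT₁₂ : T₁ < T₂) (hT₂ : T₂ ≤ T)
    (hΛ_int : ∀ i, IntervalIntegrable (Λ i) volume T₁ T₂) :
    (∀ᵐ ω ∂P, IntervalIntegrable (fun u : ℝ => spotPrice Λ Y u.toNNReal ω) volume T₁ T₂) ∧
    Integrable (futuresPayoff (spotPrice Λ Y) T₁ T₂) P ∧
    (∀ t : ℝ≥0, t ≤ T₁ →
      futuresPrice P (generatedFiltration L fun i => (hL i).measurable) (spotPrice Λ Y) T₁ T₂ t
        =ᵐ[P] fun ω =>
          (∑ i, Y i t ω * (1 / ((T₂ : ℝ) - T₁)) *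
            ∫ u in (T₁ : ℝ)..T₂, Λ i u * Real.exp (-lam i * (u - t)))
          + ∑ i, 1 / ((T₂ : ℝ) - T₁) *
            ∫ u in (T₁ : ℝ)..T₂, ∫ s in (t : ℝ)..u, ∫ z in Ioi (0 : ℝ),
              σ i s * Λ i u * Real.exp (-lam i * (u - s)) * z ∂(ν i)) ∧
    (∀ t : ℝ≥0, T₁ ≤ t → t ≤ T₂ →
      futuresPrice P (generatedFiltration L fun i => (hL i).measurable) (spotPrice Λ Y) T₁ T₂ t
        =ᵐ[P] fun ω =>
          1 / ((T₂ : ℝ) - T₁) * (∫ u in (T₁ : ℝ)..t, spotPrice Λ Y u.toNNReal ω)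
          + (∑ i, Y i t ω * (1 / ((T₂ : ℝ) - T₁)) *
            ∫ u in (t : ℝ)..T₂, Λ i u * Real.exp (-lam i * (u - t)))
          + ∑ i, 1 / ((T₂ : ℝ) - T₁) *
            ∫ u in (t : ℝ)..T₂, ∫ s in (t : ℝ)..u, ∫ z in Ioi (0 : ℝ),
              σ i s * Λ i u * Real.exp (-lam i * (u - s)) * z ∂(ν i)) := by

  have h : ∀ i, IsWeightedOU P T T₁ T₂ (Λ i) (σ i) (lam i) (y i) (ν i) (L i) (Y i) := fun i =>
    { lam_nonneg := (hlam i).le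
      sigma_meas := hσ_meas i
      sigma_nonneg := fun s hs => (hσ_pos i s hs).le
      sigma_bdd := hσ_bdd i
      levy := hL i
      int_nu := hν i
      sol := hY i
      le_horizon := hT₂
      weight_nonneg := fun u hu => (hΛ_pos i u ⟨T₁.2.trans hu.1.le,
        hu.2.trans (NNReal.coe_le_coe.2 hT₂)⟩).le
      weight_int := (intervalIntegrable_iff_integrableOn_Ioc_of_le
        (NNReal.coe_le_coe.2 hT₁₂.le)).1 (hΛ_int i) }
  refine ⟨?_, ?_, ?_, ?_⟩
  · exact (spotPrice_integral_ae h (t := 0) zero_le hT₁₂.le le_rfl le_rfl).mono fun ω hω => hω.1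
  · exact (integrable_integral_spotPrice h hT₁₂.le le_rfl le_rfl).const_mul _
  · intro t ht
    have hpay : futuresPayoff (spotPrice Λ Y) T₁ T₂ = (1 / ((T₂ : ℝ) - T₁)) •
        fun ω => ∫ u in (T₁ : ℝ)..T₂, spotPrice Λ Y u.toNNReal ω := rfl
    rw [futuresPrice, hpay]
    filter_upwards [condExp_smul (1 / ((T₂ : ℝ) - T₁))
        (fun ω => ∫ u in (T₁ : ℝ)..T₂, spotPrice Λ Y u.toNNReal ω)
        (generatedFiltration L (fun i => (hL i).measurable) t),
      condExp_integral_spotPrice h hL_indep ht hT₁₂.le le_rfl le_rfl] with ω e1 e2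
    rw [e1, Pi.smul_apply, e2, smul_eq_mul, mul_add, Finset.mul_sum, Finset.mul_sum]
    congr 1
    exact Finset.sum_congr rfl fun i _ => by ring
  · intro t ht₁ ht₂
    -- During delivery the payoff is cut at `t`: the integral up to `t` is measurable for `ℱ t` up
    -- to a null set, and the rest is priced as a delivery period starting at `t`.
    have hpay : futuresPayoff (spotPrice Λ Y) T₁ T₂ =ᵐ[P] (1 / ((T₂ : ℝ) - T₁)) •
        ((fun ω => ∫ u in (T₁ : ℝ)..t, spotPrice Λ Y u.toNNReal ω)
          + fun ω => ∫ u in (t : ℝ)..T₂, spotPrice Λ Y u.toNNReal ω) := by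
      filter_upwards [spotPrice_integral_ae h (t := 0) zero_le ht₁ le_rfl ht₂,
        spotPrice_integral_ae h (t := 0) zero_le ht₂ ht₁ le_rfl] with ω h1 h2
      rw [futuresPayoff, ← intervalIntegral.integral_add_adjacent_intervals h1.1 h2.1]
      rfl
    have hi₁ := integrable_integral_spotPrice h ht₁ le_rfl ht₂
    have hi₂ := integrable_integral_spotPrice h ht₂ ht₁ le_rfl
    rw [futuresPrice]
    filter_upwards [condExp_congr_ae (m := generatedFiltration L (fun i => (hL i).measurable) t)
        hpay,
      condExp_smul (1 / ((T₂ : ℝ) - T₁))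
        ((fun ω => ∫ u in (T₁ : ℝ)..t, spotPrice Λ Y u.toNNReal ω)
          + fun ω => ∫ u in (t : ℝ)..T₂, spotPrice Λ Y u.toNNReal ω)
        (generatedFiltration L (fun i => (hL i).measurable) t),
      condExp_add hi₁ hi₂ (generatedFiltration L (fun i => (hL i).measurable) t),
      condExp_of_aestronglyMeasurable' (Filtration.le _ t)
        (aestronglyMeasurable_integral_spotPrice h ht₁ le_rfl ht₂) hi₁,
      condExp_integral_spotPrice h hL_indep le_rfl ht₂ ht₁ le_rfl] with ω e0 e1 e2 e3 e4
    rw [e0, e1, Pi.smul_apply, e2, Pi.add_apply, e3, e4, smul_eq_mul, mul_add, mul_add,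
      Finset.mul_sum, Finset.mul_sum, add_assoc]
    congr 2
    exact Finset.sum_congr rfl fun i _ => by ring
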